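/- Let $a,b,c,d$ be primary colors, $ab,ac,ad,bc,bd,cd$ secondary colors and $abcd$ a quaternary color. Order colored parts by $$1_{abcd}<1_{ab}<1_{ac}<1_{ad}<1_a<1_{bc}<1_{bd}<1_b<1_{cd}<1_c<1_d<2_{abcd}<\cdots ;$$ a partition is a finite (possibly empty) non-increasing sequence of colored parts of positive size. Consider the table $$T=\begin{array}{|c|cccccccccc|}\hline \lambda_i\setminus\lambda_{i+1}&ab&ac&ad&a&bc&bd&b&cd&c&d\\ \hline ab&2&2&2&2&2&2&2&2&2&2\\ ac&1&2&2&2&2&2&2&2&2&2\\ ad&1&1&2&2&2&2&2&2&2&2\\ a&1&1&1&1&2&2&2&2&2&2\\ bc&1&1&1&1&2&2&2&2&2&2\\ bd&1&1&1&1&1&2&2&2&2&2\\ b&1&1&1&1&1&1&1&2&2&2\\ cd&1&1&1&1&1&1&1&2&2&2\\ c&1&1&1&1&1&1&1&1&1&2\\ d&1&1&1&1&1&1&1&1&1&1\\ \hline\end{array}$$ A **quaternary partition** is a partition with parts in the eleven colors such that: secondary parts have size greater than $1$; in the subsequence of primary and secondary parts, any two consecutive parts $\lambda_i,\lambda_{i+1}$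 differ in size by at least the entry of $T$ in the row of the color of $\lambda_i$ and the column of the color of $\lambda_{i+1}$; parts with color $abcd$ differ by at least $4$; and the smallest part with color $abcd$, if there is one, is at least $4+2\tau-\chi(1_a\text{ is a part})$, where $\tau$ is the number of primary and secondary parts and $\chi$ of a condition is $1$ if the condition holds and $0$ otherwise. For non-negative integers $u,v,w,t,n$, let $A(u,v,w,t,n)$ be the number of partitions of $n$ into $u$ distinct parts with color $a$, $v$ distinct parts with color $b$, $w$ distinct parts with color $c$ and $t$ distinct parts with color $d$, and let $B(u,v,w,t,n)$ be the number of quaternary partitions of $n$ with $u$ parts with color $a,ab,ac,ad$ or $abcd$, $v$ parts with color $b,ab,bc,bd$ or $abcd$, $w$ parts with color $c,ac,bc,cd$ or $abcd$, and $t$ parts with color $d,ad,bd,cd$ or $abcd$. Then $A(u,v,w,t,n)=B(u,v,w,t,n)$ (both finite), and for all complex $a,b,c,d,q$ with $|q|<1$ $$\sum_{u,v,w,t,n\ge 0}B(u,v,w,t,n)\,a^ub^vc^wd^tq^n=(-aq;q)_\infty(-bq;q)_\infty(-cq;q)_\infty(-dq;q)_\infty ,$$ where the sum converges absolutely and $(x;q)_\infty=\prod_{k\ge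 0}(1-xq^k)$ is a convergent product. Moreover, let $\mathcal E_1$ be the set of partitions into primary and secondary parts, with secondary parts of size greater than $1$, whose consecutive parts satisfy the minimal differences given by $T$ with the entries $(ad,bc)$ and $(cd,ab)$ lowered to $1$ and $0$, and in which no three consecutive parts are of the form $((k+2)_{cd},(k+2)_{ab},k_c)$, $((k+2)_{cd},(k+2)_{ab},k_d)$ or $((k+2)_{ad},(k+1)_{bc},k_a)$, except that $(3_{ad},2_{bc},1_a)$ is allowed. In $\nu\in\mathcal E_1$, replace each pair of consecutive parts $((k+1)_{ad},k_{bc})$ by $(2k+1)_{abcd}$ and each pair of consecutive parts $(k_{cd},k_{ab})$ by $(2k)_{abcd}$ (no two such pairs overlap); then add to each part so created twice the number of remaining primary and secondary parts standing to its left, and subtract from each remaining part twice the number of created parts standing to its right; finally arrange all parts in non-increasing order. This is a bijection from $\mathcal E_1$ onto the set of quaternary partitions, and it preserves the sum of the parts and, for each primary color, the number of parts whose color involves it. -/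

import Mathlib

namespace AAB

/-- The four primary colors. -/
inductive Primary
  | a | b | c | d
  deriving DecidableEq

/-- The eleven colors, listed in increasing order. -/
inductive Color
  | abcd | ab | ac | ad | a | bc | bd | b | cd | c | d
  deriving DecidableEq

namespace Color

/-- Position of a color in `abcd < ab < ac < ad < a < bc < bd < b < cd < c < d`. -/
def rank : Color → ℕ
  | abcd => 0
  | ab => 1
  | ac => 2
  | ad => 3
  | a => 4
  | bc => 5
  | bd => 6
  | b => 7
  | cd => 8
  | c => 9
  | d => 10

/-- The primary colors of which a color is the product. -/
def letters : Color → Finset Primary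
  | abcd => {.a, .b, .c, .d}
  | ab => {.a, .b}
  | ac => {.a, .c}
  | ad => {.a, .d}
  | a => {.a}
  | bc => {.b, .c}
  | bd => {.b, .d}
  | b => {.b}
  | cd => {.c, .d}
  | c => {.c}
  | d => {.d}

/-- `a`, `b`, `c`, `d`. -/
def IsPrimary (p : Color) : Prop := p.letters.card = 1

/-- `ab`, `ac`, `ad`, `bc`, `bd`, `cd`. -/
def IsSecondary (p : Color) : Prop := p.letters.card = 2

end Color

/-- A colored part: its size and its color. -/
structure Part where
  size : ℕ
  color : Color
  deriving DecidableEq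

/-- The order on colored parts: by size, then by color, that is
`1_abcd < 1_ab < 1_ac < 1_ad < 1_a < 1_bc < 1_bd < 1_b < 1_cd < 1_c < 1_d < 2_abcd < ⋯`. -/
def Part.le (x y : Part) : Prop :=
  x.size < y.size ∨ (x.size = y.size ∧ x.color.rank ≤ y.color.rank)

instance : DecidableRel Part.le := fun x y =>
  inferInstanceAs (Decidable (x.size < y.size ∨ (x.size = y.size ∧ x.color.rank ≤ y.color.rank)))

/-- A colored partition: a non-increasing finite sequence of colored parts of positive size
(the empty sequence is the only partition of `0`). -/
def IsPartition (l : List Part) : Prop :=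
  (∀ x ∈ l, 1 ≤ x.size) ∧ l.Pairwise (fun x y => y.le x)

/-- The number that `l` is a partition of. -/
def weight (l : List Part) : ℕ := (l.map Part.size).sum

/-- The number of parts of `l` whose color involves the primary color `p`. -/
def count (p : Primary) (l : List Part) : ℕ :=
  l.countP (fun x => decide (p ∈ x.color.letters))

/-- Partitions with primary colors only, such that the parts of each color are distinct. -/
def IsDistinctPrimary (l : List Part) : Prop :=
  IsPartition l ∧ (∀ x ∈ l, x.color.IsPrimary) ∧ l.Nodup

/-- Entry of a `10 × 10` table whose rows and columns are labelled by
`ab, ac, ad, a, bc, bd, b, cd, c, d` (only used for these ten colors). -/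
def entry (table : List (List ℕ)) (p q : Color) : ℕ :=
  (table.getD (p.rank - 1) []).getD (q.rank - 1) 0

/-- Minimal differences for the primary and secondary parts of a quaternary partition. -/
def quaternaryTable : List (List ℕ) :=
  [[2, 2, 2, 2, 2, 2, 2, 2, 2, 2],
   [1, 2, 2, 2, 2, 2, 2, 2, 2, 2],
   [1, 1, 2, 2, 2, 2, 2, 2, 2, 2],
   [1, 1, 1, 1, 2, 2, 2, 2, 2, 2],
   [1, 1, 1, 1, 2, 2, 2, 2, 2, 2],
   [1, 1, 1, 1, 1, 2, 2, 2, 2, 2],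
   [1, 1, 1, 1, 1, 1, 1, 2, 2, 2],
   [1, 1, 1, 1, 1, 1, 1, 2, 2, 2],
   [1, 1, 1, 1, 1, 1, 1, 1, 1, 2],
   [1, 1, 1, 1, 1, 1, 1, 1, 1, 1]]

/-- Minimal differences for the partitions with forbidden patterns: the previous table with the
entries `(ad, bc)` and `(cd, ab)` lowered by one. -/
def patternTable : List (List ℕ) :=
  [[2, 2, 2, 2, 2, 2, 2, 2, 2, 2],
   [1, 2, 2, 2, 2, 2, 2, 2, 2, 2],
   [1, 1, 2, 2, 1, 2, 2, 2, 2, 2],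
   [1, 1, 1, 1, 2, 2, 2, 2, 2, 2],
   [1, 1, 1, 1, 2, 2, 2, 2, 2, 2],
   [1, 1, 1, 1, 1, 2, 2, 2, 2, 2],
   [1, 1, 1, 1, 1, 1, 1, 2, 2, 2],
   [0, 1, 1, 1, 1, 1, 1, 2, 2, 2],
   [1, 1, 1, 1, 1, 1, 1, 1, 1, 2],
   [1, 1, 1, 1, 1, 1, 1, 1, 1, 1]]

/-- Consecutive terms of `l` differ by at least the entry of the table in the row of the left
(larger) part and the column of the right part. -/
def SatisfiesTable (table : List (List ℕ)) (l : List Part) : Prop :=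
  l.IsChain (fun x y => y.size + entry table x.color y.color ≤ x.size)

/-- The primary and secondary parts of `l`. -/
def ordinaryParts (l : List Part) : List Part :=
  l.filter (fun x => decide (x.color ≠ Color.abcd))

/-- The parts of `l` with color `abcd`. -/
def quaternaryParts (l : List Part) : List Part :=
  l.filter (fun x => decide (x.color = Color.abcd))

/-- Quaternary partitions. The last condition says that the smallest part with color `abcd`, if
there is one, is at least `4 + 2τ - χ(1_a is a part)`, where `τ` is the number of primary and
secondary parts. -/
def IsQuaternary (l : List Part) : Prop :=
  IsPartition l ∧
  (∀ x ∈ l, x.color.IsSecondary → 1 < x.size) ∧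
  SatisfiesTable quaternaryTable (ordinaryParts l) ∧
  (quaternaryParts l).IsChain (fun x y => y.size + 4 ≤ x.size) ∧
  (∀ x ∈ quaternaryParts l,
    4 + 2 * (ordinaryParts l).length ≤ x.size + if (⟨1, .a⟩ : Part) ∈ l then 1 else 0)

/-- The class `ℰ₁`: partitions into primary and secondary parts, with secondary parts greater
than one, satisfying the lowered table and avoiding, as consecutive parts, the patterns
`((k+2)_cd, (k+2)_ab, k_c)`, `((k+2)_cd, (k+2)_ab, k_d)` and `((k+2)_ad, (k+1)_bc, k_a)`,
except that `(3_ad, 2_bc, 1_a)` is allowed. -/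
def IsE1 (l : List Part) : Prop :=
  IsPartition l ∧
  (∀ x ∈ l, x.color.IsPrimary ∨ (x.color.IsSecondary ∧ 1 < x.size)) ∧
  SatisfiesTable patternTable l ∧
  (∀ k : ℕ, ¬ [⟨k + 2, .cd⟩, ⟨k + 2, .ab⟩, ⟨k, .c⟩] <:+: l) ∧
  (∀ k : ℕ, ¬ [⟨k + 2, .cd⟩, ⟨k + 2, .ab⟩, ⟨k, .d⟩] <:+: l) ∧
  (∀ k : ℕ, k ≠ 1 → ¬ [⟨k + 2, .ad⟩, ⟨k + 1, .bc⟩, ⟨k, .a⟩] <:+: l)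

/-- `(x, y)` is of the form `((k+1)_ad, k_bc)` or `(k_cd, k_ab)`. -/
def IsSummable (x y : Part) : Prop :=
  (x.color = .ad ∧ y.color = .bc ∧ x.size = y.size + 1) ∨
  (x.color = .cd ∧ y.color = .ab ∧ x.size = y.size)

instance : DecidableRel IsSummable := fun x y =>
  inferInstanceAs (Decidable ((x.color = .ad ∧ y.color = .bc ∧ x.size = y.size + 1) ∨
    (x.color = .cd ∧ y.color = .ab ∧ x.size = y.size)))

/-- Every consecutive pair `((k+1)_ad, k_bc)` or `(k_cd, k_ab)` is replaced by its sum, and all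
these sums are moved to the front: whenever a sum `K` crosses a remaining part `x` standing to its
left, `K` becomes `K + 2` and `x` becomes `x - 2`. The result is the sequence of sums together with
the sequence of remaining parts. -/
def split : List Part → List ℕ × List Part
  | [] => ([], [])
  | [x] => ([], [x])
  | x :: y :: l =>
    if IsSummable x y then
      let r := split l
      ((x.size + y.size) :: r.1, r.2)
    else
      let r := split (y :: l)
      (r.1.map (· + 2), ⟨x.size - 2 * r.1.length, x.color⟩ :: r.2)

/-- The map from `ℰ₁` to quaternary partitions: the sums produced by `split` get the color `abcd`,
and all parts are arranged in non-increasing order. -/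
def toQuaternary (l : List Part) : List Part :=
  ((split l).1.map (fun K => (⟨K, .abcd⟩ : Part)) ++ (split l).2).insertionSort
    (fun x y => y.le x)

/-- The partitions of `n` satisfying `P` in which the numbers of parts whose color involves
`a`, `b`, `c`, `d` are `u`, `v`, `w`, `t` respectively. -/
def refined (P : List Part → Prop) (u v w t n : ℕ) : Set (List Part) :=
  {l | P l ∧ count .a l = u ∧ count .b l = v ∧ count .c l = w ∧ count .d l = t ∧ weight l = n}

/-- `A(u,v,w,t,n)`. -/
noncomputable def A (u v w t n : ℕ) : ℕ := (refined IsDistinctPrimary u v w t n).ncard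

/-- `B(u,v,w,t,n)`. -/
noncomputable def B (u v w t n : ℕ) : ℕ := (refined IsQuaternary u v w t n).ncard

/-- `(x; q)_∞ = ∏_{k ≥ 0} (1 - x q^k)`, for `|q| < 1`. -/
noncomputable def qPoch (x q : ℂ) : ℂ := ∏' k : ℕ, (1 - x * q ^ k)

end AAB

/-! Two weight- and color-preserving bijections are composed: from partitions into distinct primary
parts to `ℰ₁`, and from `ℰ₁` to quaternary partitions by `toQuaternary`. The generating function
then comes from expanding the product over all colors and sizes.

For the first, primary parts are ranked by `pos`, and a secondary part is a sum of two primary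
parts, its halves, whose ranks differ by less than `4`. Primary parts are inserted one by one, the
largest first (`glue`). If the new part is too close to a smallest part that is itself primary, the
two merge, and the merged part climbs past every primary part that is too close, gaining `1` while
the crossed part loses `1` (`push`). The climb of the smallest secondary part can be undone from the
list alone: `front` lowers it by the number of primary parts below it, and comparing the result with
the smallest part gives `bottom`, the rank inserted last. A part may be inserted when its rank is
below `bottom`; this makes insertion well defined and reversible (`ins_spec`, `ins_injective`,
`exists_ins_eq`). The forbidden patterns are the lists in which undoing a climb would leave a raised
primary part too close to the next secondary part.

For the second, a partition in `ℰ₁` becomes a word whose letters are the sums `K` of its summable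
pairs and its remaining parts. That a part may stand before `K`, or after it, is one inequality
between `K`, twice the size and a constant of the color (`canPrecede_iff`, `canFollow_iff`). When
`K` crosses a part, `K` gains `2` and the part loses `2`, and of the two orders exactly one is legal
(`canPrecede_shift_iff`). So the sums and the remaining parts, kept as separate sequences, determine
the word (`splitWord_injective`), and every admissible pair of sequences arises
(`exists_splitWord_eq`). The sole exception to the dichotomy is `K = 5` followed by `1_a`; it
accounts for the allowed pattern and for the term `χ`. -/

namespace AAB
set_option linter.constructorNameAsVariable false

/-! ### Ranks of primary parts and the halves of secondary parts. -/

/-- Whether a color is secondary. -/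
def Color.isSec : Color → Bool
  | ab => true | ac => true | ad => true | bc => true | bd => true | cd => true
  | _ => false

/-- Position in `a < b < c < d` of the smallest letter of a color. -/
def Color.fst : Color → ℕ
  | b => 1 | bc => 1 | bd => 1 | c => 2 | cd => 2 | d => 3
  | _ => 0

/-- Position in `a < b < c < d` of the largest letter of a secondary color. -/
def Color.snd : Color → ℕ
  | ab => 1 | ac => 2 | bc => 2 | ad => 3 | bd => 3 | cd => 3
  | _ => 0

namespace Part

/-- Whether a part is secondary. -/
def isSec (x : Part) : Bool := x.color.isSec

/-- The rank of a primary part in the order of primary parts; for a secondary part, the rank of the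
primary part of the same size whose color is its smallest letter. -/
def pos (x : Part) : ℕ := 4 * x.size + x.color.fst

/-- A secondary part is the sum of two primary parts whose ranks differ by less than `4`; this is
the rank of the larger one. -/
def hi (x : Part) : ℕ :=
  4 * ((x.size + 1) / 2) + x.color.snd * ((x.size + 1) % 2) + x.color.fst * (x.size % 2)

/-- A secondary part is the sum of two primary parts whose ranks differ by less than `4`; this is
the rank of the smaller one. -/
def lo (x : Part) : ℕ :=
  4 * (x.size / 2) + x.color.fst * ((x.size + 1) % 2) + x.color.snd * (x.size % 2)

/-- The part with size increased by one. -/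
def inc (x : Part) : Part := ⟨x.size + 1, x.color⟩

/-- The part with size decreased by one. -/
def dec (x : Part) : Part := ⟨x.size - 1, x.color⟩

/-- Primary parts of positive size and secondary parts of size greater than one. -/
def Good (x : Part) : Prop :=
  x.color ≠ .abcd ∧ 1 ≤ x.size ∧ (x.isSec = true → 2 ≤ x.size)

@[simp] lemma isSec_inc (x : Part) : x.inc.isSec = x.isSec := rfl
@[simp] lemma isSec_dec (x : Part) : x.dec.isSec = x.isSec := rfl
@[simp] lemma dec_inc (x : Part) : x.inc.dec = x := rfl
@[simp] lemma pos_inc (x : Part) : x.inc.pos = x.pos + 4 := by simp only [pos, inc]; omega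
lemma inc_dec {x : Part} (h : 1 ≤ x.size) : x.dec.inc = x := by
  obtain ⟨k, c⟩ := x
  simp only [dec, inc, Part.mk.injEq, and_true] at *
  omega
lemma pos_dec {x : Part} (h : 1 ≤ x.size) : x.dec.pos + 4 = x.pos := by
  simp only [pos, dec]; omega
-- Raising a secondary part by `1` raises its lower half by one unit of size, that is by rank `4`;
-- this half overtakes the other one, so the two exchange roles.
@[simp] lemma lo_inc (x : Part) : x.inc.lo = x.hi := by
  obtain ⟨k, c⟩ := x
  simp only [lo, hi, inc, add_assoc k 1 1, Nat.add_mod_right]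
  ring
@[simp] lemma hi_inc (x : Part) : x.inc.hi = x.lo + 4 := by
  obtain ⟨k, c⟩ := x
  have h : (k + 2) / 2 = k / 2 + 1 := by omega
  simp only [lo, hi, inc, add_assoc k 1 1, Nat.add_mod_right, Nat.reduceAdd, h]
  ring
lemma hi_dec {x : Part} (h : 1 ≤ x.size) : x.dec.hi = x.lo := by
  conv_rhs => rw [← inc_dec h, lo_inc]
lemma Good.inc {x : Part} (h : x.Good) : x.inc.Good :=
  ⟨h.1, by simp [Part.inc], fun _ => by have := h.2.1; simp only [Part.inc]; omega⟩

lemma lo_lt_hi {x : Part} (h : x.isSec = true) : x.lo < x.hi ∧ x.hi < x.lo + 4 := by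
  obtain ⟨k, c⟩ := x
  cases c <;> simp [isSec, Color.isSec] at h <;> simp only [lo, hi, Color.fst, Color.snd] <;>
    omega

end Part

open AAB.Part

/-! ### The table of `ℰ₁` as inequalities between ranks. -/

/-- The minimal difference condition of `patternTable` for a part `x` directly below `y`. -/
def Sep (x y : Part) : Prop := x.size + entry patternTable y.color x.color ≤ y.size

lemma Sep.inc {x y : Part} (h : Sep x y) : Sep x.inc y.inc := by
  simp only [Sep, Part.inc] at *; omega

lemma sep_inc_inc {x y : Part} : Sep x.inc y.inc ↔ Sep x y := by
  simp only [Sep, Part.inc]; omega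

/-- Together with the three lemmas that follow, this replaces the table by rank inequalities, so
that the insertion argument rarely looks at colors. -/
lemma sep_prim_prim {x y : Part} (hx : x.Good) (hy : y.Good) (sx : x.isSec = false)
    (sy : y.isSec = false) : Sep x y ↔ x.pos + 4 ≤ y.pos := by
  obtain ⟨k, c⟩ := x
  obtain ⟨m, e⟩ := y
  cases c <;> simp [isSec, Color.isSec, Good] at sx hx <;>
  cases e <;> simp [isSec, Color.isSec, Good] at sy hy <;>
  simp [Sep, entry, patternTable, Color.rank, pos, Color.fst] <;> omega

lemma sep_prim_sec {x y : Part} (hx : x.Good) (hy : y.Good) (sx : x.isSec = false)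
    (sy : y.isSec = true) : Sep x y ↔ x.pos + 4 < y.pos := by
  obtain ⟨k, c⟩ := x
  obtain ⟨m, e⟩ := y
  cases c <;> simp [isSec, Color.isSec, Good] at sx hx <;>
  cases e <;> simp [isSec, Color.isSec, Good] at sy hy <;>
  simp [Sep, entry, patternTable, Color.rank, pos, Color.fst] <;> omega

lemma sep_sec_prim {x y : Part} (hx : x.Good) (hy : y.Good) (sx : x.isSec = true)
    (sy : y.isSec = false) : Sep x y ↔ x.pos + 4 ≤ y.pos := by
  obtain ⟨k, c⟩ := x
  obtain ⟨m, e⟩ := y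
  cases c <;> simp [isSec, Color.isSec, Good] at sx hx <;>
  cases e <;> simp [isSec, Color.isSec, Good] at sy hy <;>
  simp [Sep, entry, patternTable, Color.rank, pos, Color.fst] <;> omega

/-- As `y.hi = y.dec.lo + 4`, the condition reads `x.hi < y.lo` or `x.lo + 4 < y.hi`. The form with
`dec` is the one that `bottom` tests. -/
lemma sep_sec_sec {x y : Part} (hx : x.Good) (hy : y.Good) (sx : x.isSec = true)
    (sy : y.isSec = true) : Sep x y ↔ ¬ (y.lo ≤ x.hi ∧ y.dec.lo ≤ x.lo) := by
  obtain ⟨k, c⟩ := x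
  obtain ⟨m, e⟩ := y
  cases c <;> simp [isSec, Color.isSec, Good] at sx hx <;>
  cases e <;> simp [isSec, Color.isSec, Good] at sy hy <;>
  simp only [Sep, entry, patternTable, Color.rank, lo, hi, dec, Color.fst, Color.snd,
    List.getD_cons_succ, List.getD_cons_zero, Nat.reduceSub] <;>
  first | omega | (obtain ⟨i, hi | hi⟩ : ∃ i, k = 2 * i ∨ k = 2 * i + 1 := ⟨k / 2, by omega⟩ <;>
    obtain ⟨j, hj | hj⟩ : ∃ i, m = 2 * i ∨ m = 2 * i + 1 := ⟨m / 2, by omega⟩ <;> omega)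

lemma sep_of_pos {x y : Part} (hx : x.Good) (hy : y.Good) (sx : x.isSec = true)
    (sy : y.isSec = true) (h : x.pos + 4 < y.pos) : Sep x y := by
  obtain ⟨k, c⟩ := x
  obtain ⟨m, e⟩ := y
  cases c <;> simp [isSec, Color.isSec, Good] at sx hx <;>
  cases e <;> simp [isSec, Color.isSec, Good] at sy hy <;>
  simp [Sep, entry, patternTable, Color.rank, pos, Color.fst] at h ⊢ <;> omega

/-- The upper half of a secondary part is well below whatever the part is well below. -/
lemma hi_lt_pos {x y : Part} (hx : x.Good) (hy : y.Good) (sx : x.isSec = true)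
    (sy : y.isSec = true) (h : Sep x y) : x.hi + 4 < y.pos := by
  obtain ⟨k, c⟩ := x
  obtain ⟨m, e⟩ := y
  cases c <;> simp [isSec, Color.isSec, Good] at sx hx <;>
  cases e <;> simp [isSec, Color.isSec, Good] at sy hy <;>
  simp only [Sep, entry, patternTable, Color.rank, hi, pos, Color.fst, Color.snd,
    List.getD_cons_succ, List.getD_cons_zero, Nat.reduceSub] at h ⊢ <;> omega

lemma hi_le_pos {x : Part} (hx : x.Good) (sx : x.isSec = true) : x.hi ≤ x.pos := by
  obtain ⟨k, c⟩ := x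
  cases c <;> simp [isSec, Color.isSec, Good] at sx hx <;>
  simp only [hi, pos, Color.fst, Color.snd] <;> omega

/-- Only the two lowered entries let consecutive secondary parts come closer than one unit of size
in rank, and then the parts form a summable pair. -/
lemma pos_le_or_of_sep {x y : Part} (hx : x.Good) (hy : y.Good) (sx : x.isSec = true)
    (sy : y.isSec = true) (h : Sep x y) :
    (x.pos + 4 ≤ y.pos ∧ x.size + 1 ≤ y.size) ∨
      (x.color = .bc ∧ y.color = .ad ∧ y.size = x.size + 1) ∨
      (x.color = .ab ∧ y.color = .cd ∧ y.size = x.size) := by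
  obtain ⟨k, c⟩ := x
  obtain ⟨m, e⟩ := y
  cases c <;> simp [isSec, Color.isSec, Good] at sx hx <;>
  cases e <;> simp [isSec, Color.isSec, Good] at sy hy <;>
  simp [Sep, entry, patternTable, Color.rank, pos, Color.fst] at h ⊢ <;> omega

/-- The outer sizes differ by at least `2`, even across a lowered entry. This is `NoPattern` for the
upper half of `x` placed below `y` and `z`, needed when `x` is split into its halves. -/
lemma hi_lt_pos_of_sep_sep {x y z : Part} (hx : x.Good) (hy : y.Good) (hz : z.Good)
    (sx : x.isSec = true) (sy : y.isSec = true) (sz : z.isSec = true) (h : Sep x y)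
    (h' : Sep y z) : x.hi + 8 < z.pos := by
  have h2 : x.size + 2 ≤ z.size := by
    have h3 : x.size + 1 ≤ y.size ∨ x.size = y.size ∧ y.color = .cd := by
      rcases pos_le_or_of_sep hx hy sx sy h with h | h | h
      · omega
      · omega
      · exact Or.inr ⟨h.2.2.symm, h.2.1⟩
    rcases pos_le_or_of_sep hy hz sy sz h' with h'' | h'' | h''
    · rcases h3 with h3 | ⟨h3, h4⟩
      · omega
      · obtain ⟨n, f⟩ := z
        cases f <;> simp [isSec, Color.isSec] at sz <;>
          simp [Sep, entry, patternTable, Color.rank, pos, Color.fst, h4] at h' h'' <;> simp <;>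
          omega
    · rcases h3 with h3 | ⟨h3, h4⟩
      · omega
      · simp [h4] at h''
    · simp only [Sep, h''.1] at h
      obtain ⟨k, c⟩ := x
      cases c <;> simp [isSec, Color.isSec] at sx <;>
        simp [entry, patternTable, Color.rank] at h h'' ⊢ <;> omega
  have h5 : z.pos = 4 * z.size + z.color.fst := rfl
  obtain ⟨k, c⟩ := x
  cases c <;> simp [isSec, Color.isSec, Good] at sx hx <;>
  simp only [hi, Color.fst, Color.snd] at h2 ⊢ <;> omega

/-- The conclusion is what `NoPattern` demands of `s.inc`, `y`, `z` once `x` has been taken out and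
`s` raised. -/
lemma pos_lt_of_sep_sep {s x y z : Part} (hs : s.Good) (hx : x.Good) (hy : y.Good) (hz : z.Good)
    (ss : s.isSec = false) (sx : x.isSec = true) (sy : y.isSec = true) (sz : z.isSec = true)
    (h0 : Sep s x) (h : Sep x y) (h' : Sep y z) (h1 : s.pos + 8 < y.pos) :
    s.pos + 12 < z.pos := by
  rw [sep_prim_sec hs hx ss sx] at h0
  have h5 : y.pos = 4 * y.size + y.color.fst := rfl
  have h6 : z.pos = 4 * z.size + z.color.fst := rfl
  rcases pos_le_or_of_sep hy hz sy sz h' with h'' | h'' | h''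
  · omega
  all_goals
    simp only [Sep, h''.1, h''.2.1, Color.fst] at h h5 h6
    generalize s.pos = n at *
    obtain ⟨k, c⟩ := x
    cases c <;> simp [isSec, Color.isSec] at sx <;>
      simp [entry, patternTable, Color.rank, pos, Color.fst] at h h0 <;> omega

lemma Part.ext_of_pos {x y : Part} (hx : x.Good) (hy : y.Good) (sx : x.isSec = false)
    (sy : y.isSec = false) (h : x.pos = y.pos) : x = y := by
  obtain ⟨k, c⟩ := x
  obtain ⟨m, e⟩ := y
  cases c <;> simp [isSec, Color.isSec, Good] at sx hx <;>
  cases e <;> simp [isSec, Color.isSec, Good] at sy hy <;>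
  simp [pos, Color.fst] at h ⊢ <;> omega

/-! ### Merging two primary parts. -/

/-- The secondary color with two given letters. -/
def mergeColor : Color → Color → Color
  | .a, .b => .ab | .a, .c => .ac | .a, .d => .ad | .b, .a => .ab | .b, .c => .bc | .b, .d => .bd
  | .c, .a => .ac | .c, .b => .bc | .c, .d => .cd | .d, .a => .ad | .d, .b => .bd | .d, .c => .cd
  | _, _ => .abcd

/-- The sum of two primary parts. -/
def merge (x y : Part) : Part := ⟨x.size + y.size, mergeColor x.color y.color⟩

lemma merge_spec {x y : Part} (hx : x.Good) (hy : y.Good) (sx : x.isSec = false)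
    (sy : y.isSec = false) (h : y.pos < x.pos) (h' : x.pos < y.pos + 4) :
    (merge x y).Good ∧ (merge x y).isSec = true ∧ (merge x y).hi = x.pos ∧
      (merge x y).lo = y.pos := by
  obtain ⟨k, c⟩ := x
  obtain ⟨m, e⟩ := y
  cases c <;> simp [isSec, Color.isSec, Good] at sx hx <;>
  cases e <;> simp [isSec, Color.isSec, Good] at sy hy <;>
  simp [pos, Color.fst] at h h' <;> first | (exfalso; omega) |
  (simp only [merge, mergeColor, isSec, Color.isSec, Good, hi, lo, pos, Color.fst, Color.snd, ne_eq,
    reduceCtorEq, not_false_eq_true, true_and, forall_const]; omega)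

lemma exists_merge {x : Part} (hx : x.Good) (sx : x.isSec = true) :
    ∃ y z : Part, y.Good ∧ z.Good ∧ y.isSec = false ∧ z.isSec = false ∧ y.pos = x.hi ∧
      z.pos = x.lo ∧ merge y z = x := by
  obtain ⟨k, c⟩ := x
  obtain ⟨m, rfl | rfl⟩ : ∃ m, k = 2 * m ∨ k = 2 * m + 1 := ⟨k / 2, by omega⟩
  · cases c <;> simp [isSec, Color.isSec, Good] at sx hx
    · refine ⟨⟨m, .b⟩, ⟨m, .a⟩, ?_⟩
      simp [merge, mergeColor, isSec, Color.isSec, Good, hi, lo, pos, Color.fst, Color.snd]; omega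
    · refine ⟨⟨m, .c⟩, ⟨m, .a⟩, ?_⟩
      simp [merge, mergeColor, isSec, Color.isSec, Good, hi, lo, pos, Color.fst, Color.snd]; omega
    · refine ⟨⟨m, .d⟩, ⟨m, .a⟩, ?_⟩
      simp [merge, mergeColor, isSec, Color.isSec, Good, hi, lo, pos, Color.fst, Color.snd]; omega
    · refine ⟨⟨m, .c⟩, ⟨m, .b⟩, ?_⟩
      simp [merge, mergeColor, isSec, Color.isSec, Good, hi, lo, pos, Color.fst, Color.snd]; omega
    · refine ⟨⟨m, .d⟩, ⟨m, .b⟩, ?_⟩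
      simp [merge, mergeColor, isSec, Color.isSec, Good, hi, lo, pos, Color.fst, Color.snd]; omega
    · refine ⟨⟨m, .d⟩, ⟨m, .c⟩, ?_⟩
      simp [merge, mergeColor, isSec, Color.isSec, Good, hi, lo, pos, Color.fst, Color.snd]; omega
  · cases c <;> simp [isSec, Color.isSec, Good] at sx hx
    · refine ⟨⟨m + 1, .a⟩, ⟨m, .b⟩, ?_⟩
      simp [merge, mergeColor, isSec, Color.isSec, Good, hi, lo, pos, Color.fst, Color.snd]; omega
    · refine ⟨⟨m + 1, .a⟩, ⟨m, .c⟩, ?_⟩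
      simp [merge, mergeColor, isSec, Color.isSec, Good, hi, lo, pos, Color.fst, Color.snd]; omega
    · refine ⟨⟨m + 1, .a⟩, ⟨m, .d⟩, ?_⟩
      simp [merge, mergeColor, isSec, Color.isSec, Good, hi, lo, pos, Color.fst, Color.snd]; omega
    · refine ⟨⟨m + 1, .b⟩, ⟨m, .c⟩, ?_⟩
      simp [merge, mergeColor, isSec, Color.isSec, Good, hi, lo, pos, Color.fst, Color.snd]; omega
    · refine ⟨⟨m + 1, .b⟩, ⟨m, .d⟩, ?_⟩
      simp [merge, mergeColor, isSec, Color.isSec, Good, hi, lo, pos, Color.fst, Color.snd]; omega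
    · refine ⟨⟨m + 1, .c⟩, ⟨m, .d⟩, ?_⟩
      simp [merge, mergeColor, isSec, Color.isSec, Good, hi, lo, pos, Color.fst, Color.snd]; omega

/-! ### The class `ℰ₁` read from its smallest part. -/

/-- The condition on three consecutive parts `x`, `y`, `z` (in increasing order) that excludes the
forbidden patterns. -/
def NoPattern (x y z : Part) : Prop :=
  x.isSec = false → y.isSec = true → z.isSec = true → y.lo ≤ x.pos → x.pos + 8 < z.pos

/-- The condition for putting the part `x` below the smallest parts of a list. -/
def FitsBelow (x : Part) : List Part → Prop
  | [] => True
  | [y] => Sep x y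
  | y :: z :: _ => Sep x y ∧ NoPattern x y z

/-- The partitions of the class `ℰ₁`, listed in increasing order. -/
def Admissible : List Part → Prop
  | [] => True
  | x :: l => x.Good ∧ FitsBelow x l ∧ Admissible l

lemma FitsBelow.sep {x y : Part} {l : List Part} (h : FitsBelow x (y :: l)) : Sep x y := by
  cases l with
  | nil => exact h
  | cons z l => exact h.1

lemma fitsBelow_of_isSec {x : Part} (hx : x.isSec = true) :
    ∀ {l : List Part}, (∀ y ∈ l.head?, Sep x y) → FitsBelow x l
  | [], _ => trivial
  | [y], h => h y (by simp)
  | y :: z :: l, h => ⟨h y (by simp), fun h' => by simp [hx] at h'⟩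

lemma fitsBelow_prim {x y : Part} (hy : y.isSec = false) :
    ∀ {l : List Part}, Sep x y → FitsBelow x (y :: l)
  | [], h => h
  | z :: l, h => ⟨h, fun _ h' => by simp [hy] at h'⟩

lemma fitsBelow_sec_prim {x y z : Part} {l : List Part} (hz : z.isSec = false) (h : Sep x y) :
    FitsBelow x (y :: z :: l) :=
  ⟨h, fun _ _ h' => by simp [hz] at h'⟩

/-! ### Insertion of a primary part. -/

/-- The smallest secondary part, decreased by the number of primary parts below it. -/
def front : List Part → Option Part
  | [] => none
  | x :: l => if x.isSec then some x else (front l).map dec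

/-- The rank of the primary part whose insertion produces the given nonempty list. -/
def bottom : List Part → ℕ
  | [] => 0
  | x :: l => if x.isSec then x.lo else
      match front l with
      | none => x.pos
      | some y => if y.lo ≤ x.pos then y.dec.lo else x.pos

/-- Move a secondary part up through a list of parts until it fits. -/
def push (x : Part) : List Part → List Part
  | [] => [x]
  | y :: l => if y.isSec = false ∧ y.pos < x.pos + 4 then y.dec :: push x.inc l else x :: y :: l

/-- The inverse of `push`: the list without its smallest secondary part. -/
def pull : List Part → List Part
  | [] => []
  | x :: l => if x.isSec then l else x.inc :: pull l

/-- Insert a primary part into a list. -/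
def ins (x : Part) : List Part → List Part
  | [] => [x]
  | y :: l => if y.isSec = false ∧ y.pos < x.pos + 4 then push (merge y x) l else x :: y :: l

lemma isSec_of_front {l : List Part} {y : Part} (h : front l = some y) : y.isSec = true := by
  induction l generalizing y with
  | nil => simp [front] at h
  | cons x l ih =>
    rw [front] at h
    split_ifs at h with hx
    · simp only [Option.some.injEq] at h; exact h ▸ hx
    · obtain ⟨z, hz, rfl⟩ := Option.map_eq_some_iff.1 h
      simpa using ih hz

/-- The front part lies above every primary part. -/
lemma pos_lt_front {x y : Part} {l : List Part} (h : Admissible (x :: l)) (hx : x.isSec = false)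
    (hy : front l = some y) : x.pos + 4 < y.pos ∧ 2 ≤ y.size ∧ (y.lo ≤ x.pos → 3 ≤ y.size) := by
  induction l generalizing x y with
  | nil => simp [front] at hy
  | cons z l ih =>
    obtain ⟨gx, hs, gz, h'⟩ := id h
    have hs := hs.sep
    have hp : 4 ≤ x.pos := by have := gx.2.1; simp only [pos]; omega
    have key : x.pos + 4 < y.pos := by
      rw [front] at hy
      split_ifs at hy with hz
      · obtain rfl : z = y := by simpa using hy
        exact (sep_prim_sec gx gz hx hz).1 hs
      · obtain ⟨w, hw, rfl⟩ := Option.map_eq_some_iff.1 hy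
        simp only [Bool.not_eq_true] at hz
        obtain ⟨h1, -⟩ := ih ⟨gz, h'⟩ hz hw
        have h2 := (sep_prim_prim gx gz hx hz).1 hs
        have : 1 ≤ w.size := by
          have h3 : w.pos = 4 * w.size + w.color.fst := rfl
          have : w.color.fst < 4 := by cases w.color <;> simp [Color.fst]
          have : 4 ≤ z.pos := by omega
          omega
        have := pos_dec this
        omega
    refine ⟨key, ?_⟩
    have sy := isSec_of_front hy
    clear * - key hp sy
    generalize x.pos = n at *
    obtain ⟨k, c⟩ := y
    cases c <;> simp [isSec, Color.isSec] at sy <;>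
      simp only [pos, lo, Color.fst, Color.snd] at key hp ⊢ <;> omega

/-- If primary parts intervene, the gap from `x` to the first of them and the gap from that one to
the uncrossed front part add up, even after the last lowering, to more than a secondary pair needs.
-/
lemma sep_front {x y : Part} {l : List Part} (gx : x.Good) (hx : x.isSec = true)
    (h : Admissible l) (hs : ∀ z ∈ l.head?, Sep x z) (hy : front l = some y) : Sep x y := by
  cases l with
  | nil => simp [front] at hy
  | cons z l =>
    have hs := hs z (by simp)
    have hy' := hy
    rw [front] at hy
    split_ifs at hy with hz
    · obtain rfl : z = y := by simpa using hy
      exact hs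
    · obtain ⟨w, hw, rfl⟩ := Option.map_eq_some_iff.1 hy
      simp only [Bool.not_eq_true] at hz
      have h1 := pos_lt_front h hz hw
      have h2 := (sep_sec_prim gx h.1 hx hz).1 hs
      have h3 : 1 ≤ w.size := by omega
      have h4 : w.isSec = true := isSec_of_front hw
      have h5 := pos_dec h3
      have h6 : 2 ≤ x.size := gx.2.2 hx
      apply sep_of_pos gx _ hx (by simpa using h4) (by omega)
      have h7 : w.color.fst < 4 := by cases w.color <;> simp [Color.fst]
      have h8 : w.dec.pos = 4 * w.dec.size + w.color.fst := rfl
      have h9 : x.pos = 4 * x.size + x.color.fst := rfl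
      refine ⟨?_, by omega, fun _ => by omega⟩
      intro h
      have : w.color = .abcd := h
      simp [Part.isSec, this, Color.isSec] at h4

/-- The hypotheses under which a secondary part can be pushed into a list. -/
structure Pushable (x : Part) (l : List Part) : Prop where
  good : x.Good
  isSec : x.isSec = true
  adm : Admissible l
  head : ∀ y ∈ l.head?, y.isSec = false → x.hi + 4 ≤ y.pos
  front : ∀ y, front l = some y → Sep x y

lemma four_le_lo {x : Part} (gx : x.Good) (hx : x.isSec = true) : 4 ≤ x.lo := by
  have := gx.2.2 hx
  simp only [lo]
  omega

lemma Part.Good.dec {x : Part} (gx : x.Good) (hx : x.isSec = false) (h : 8 ≤ x.pos) : x.dec.Good := by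
  refine ⟨gx.1, ?_, fun h => by simp [hx] at h⟩
  obtain ⟨k, c⟩ := x
  cases c <;> simp [pos, Part.dec, Color.fst] at * <;> omega

/-- Crossing `y` raises `x` by one, and the front of the rest is no longer lowered for `y`; their
difference is unchanged, which keeps the climb going. -/
lemma Pushable.tail {x y : Part} {l : List Part} (h : Pushable x (y :: l)) (hy : y.isSec = false) :
    Pushable x.inc l where
  good := h.good.inc
  isSec := h.isSec
  adm := h.adm.2.2
  head z hz sz := by
    cases l with
    | nil => simp at hz
    | cons w l =>
      obtain rfl : w = z := by simpa using hz
      have h1 := (sep_prim_prim h.adm.1 h.adm.2.2.1 hy sz).1 h.adm.2.1.sep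
      have h2 := h.head y (by simp) hy
      have h3 := lo_lt_hi h.isSec
      rw [hi_inc]
      omega
  front z hz := by
    have h1 := h.front z.dec (by simp [AAB.front, hy, hz])
    have h2 := pos_lt_front h.adm hy hz
    rw [← inc_dec (x := z) (by omega), sep_inc_inc]
    exact h1

/-- Here `y` is a part already crossed and lowered: the bounds by `8` are its former distance `4`
plus the `4` lost in the crossing. For a secondary `z` the bound is the conclusion of `NoPattern`.
-/
lemma fitsBelow_push {x y : Part} {l : List Part} (h : Pushable x l) (gy : y.Good)
    (hy : y.isSec = false) (h1 : y.pos + 4 < x.pos)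
    (h2 : ∀ z ∈ l.head?, z.isSec = false → y.pos + 8 ≤ z.pos)
    (h3 : ∀ z ∈ l.head?, z.isSec = true → y.pos + 8 < z.pos) : FitsBelow y (push x l) := by
  have hs : Sep y x := (sep_prim_sec gy h.good hy h.isSec).2 h1
  cases l with
  | nil => exact hs
  | cons z l =>
    rw [push]
    split_ifs with hz
    · apply fitsBelow_prim (by simpa using hz.1)
      have h4 := h2 z (by simp) hz.1
      have h5 := pos_dec h.adm.1.2.1
      have h6 : 4 ≤ y.pos := by have := gy.2.1; simp only [pos]; omega
      rw [sep_prim_prim gy (h.adm.1.dec hz.1 (by omega)) hy (by simpa using hz.1)]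
      omega
    · cases sz : z.isSec
      · exact fitsBelow_sec_prim sz hs
      · exact ⟨hs, fun _ _ _ _ => h3 z (by simp) sz⟩

/-- Each crossing adds `1` to the climbing part and puts one primary part below it, so `front` gives
back the part that started the climb. -/
lemma push_spec {x : Part} {l : List Part} (h : Pushable x l) :
    Admissible (push x l) ∧ front (push x l) = some x ∧ bottom (push x l) = x.lo := by
  induction l generalizing x with
  | nil => exact ⟨⟨h.good, trivial, trivial⟩, by simp [push, front, h.isSec],
      by simp [push, bottom, h.isSec]⟩
  | cons y l ih =>
    rw [push]
    split_ifs with hy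
    · have h' := h.tail hy.1
      obtain ⟨h1, h2, -⟩ := ih h'
      have h3 := h.head y (by simp) hy.1
      have h4 := four_le_lo h.good h.isSec
      have h5 := lo_lt_hi h.isSec
      have h6 := pos_dec h.adm.1.2.1
      refine ⟨⟨h.adm.1.dec hy.1 (by omega), fitsBelow_push h' (h.adm.1.dec hy.1 (by omega))
        (by simpa using hy.1) (by rw [pos_inc]; omega) ?_ ?_, h1⟩, by simp [front, hy.1, h2], ?_⟩
      · intro z hz sz
        cases l with
        | nil => simp at hz
        | cons w l =>
          obtain rfl : w = z := by simpa using hz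
          have h1 := (sep_prim_prim h.adm.1 h.adm.2.2.1 hy.1 sz).1 h.adm.2.1.sep
          omega
      · intro z hz sz
        cases l with
        | nil => simp at hz
        | cons w l =>
          obtain rfl : w = z := by simpa using hz
          have h1 := (sep_prim_sec h.adm.1 h.adm.2.2.1 hy.1 sz).1 h.adm.2.1.sep
          omega
      -- The test in `bottom` compares `y.dec` with the lower half of `x.inc`, which is `x.hi`.
      · have h7 : x.hi ≤ y.dec.pos := by omega
        simp [bottom, hy.1, h2, h7]
    · refine ⟨⟨h.good, fitsBelow_of_isSec h.isSec ?_, h.adm⟩, by simp [front, h.isSec],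
        by simp [bottom, h.isSec]⟩
      intro z hz
      obtain rfl : y = z := by simpa using hz
      cases sy : y.isSec
      · rw [sep_sec_prim h.good h.adm.1 h.isSec sy]
        simp only [sy, true_and] at hy
        omega
      · exact h.front y (by simp [front, sy])

lemma pull_push {x : Part} {l : List Part} (h : Pushable x l) : pull (push x l) = l := by
  induction l generalizing x with
  | nil => simp [push, pull, h.isSec]
  | cons y l ih =>
    rw [push]
    split_ifs with hy
    · simp [pull, hy.1, ih (h.tail hy.1), inc_dec h.adm.1.2.1]
    · simp [pull, h.isSec]

lemma Part.Good.of_isSec {x : Part} (hx : x.isSec = true) (h : 2 ≤ x.size) : x.Good := by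
  refine ⟨fun h' => ?_, by omega, fun _ => h⟩
  simp [Part.isSec, h', Color.isSec] at hx

/-- In the case where `bottom` is not the rank of `y`, it is the lower half of a part whose upper
half is at most that rank. -/
lemma pos_lt_of_lt_bottom {x y : Part} {l : List Part} (hl : Admissible (y :: l))
    (sy : y.isSec = false) (h : x.pos < bottom (y :: l)) : x.pos < y.pos := by
  rw [bottom] at h
  simp only [sy, Bool.false_eq_true, if_false] at h
  cases hf : front l with
  | none => simpa [hf] using h
  | some z =>
    simp only [hf] at h
    split_ifs at h with h1
    · have h2 := pos_lt_front hl sy hf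
      have h3 := lo_lt_hi (x := z.dec) (by simpa using isSec_of_front hf)
      have h4 := hi_dec (x := z) (by omega)
      omega
    · exact h

/-- The bound by `bottom` is made for this: the merged part has halves `y` and `x`, so failing to be
separated from the front `z` means `z.lo ≤ y.pos` and `z.dec.lo ≤ x.pos`; the first makes `bottom`
equal to `z.dec.lo`, and the second then contradicts the bound. -/
lemma pushable_merge {x y : Part} {l : List Part} (gx : x.Good) (hx : x.isSec = false)
    (hl : Admissible (y :: l)) (sy : y.isSec = false) (h : x.pos < bottom (y :: l))
    (hy : y.pos < x.pos + 4) : Pushable (merge y x) l := by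
  have hxy := pos_lt_of_lt_bottom hl sy h
  obtain ⟨h1, h2, h3, h4⟩ := merge_spec hl.1 gx sy hx hxy hy
  refine ⟨h1, h2, hl.2.2, ?_, ?_⟩
  · intro z hz sz
    cases l with
    | nil => simp at hz
    | cons w l =>
      obtain rfl : w = z := by simpa using hz
      have := (sep_prim_prim hl.1 hl.2.2.1 sy sz).1 hl.2.1.sep
      omega
  · intro z hz
    simp only [bottom, sy, Bool.false_eq_true, if_false, hz] at h
    have h5 := pos_lt_front hl sy hz
    have h6 := isSec_of_front hz
    rw [sep_sec_sec h1 (.of_isSec h6 h5.2.1) h2 h6, h3, h4]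
    rintro ⟨h7, h8⟩
    rw [if_pos h7] at h
    omega

/-- The rank just inserted becomes the new `bottom`, so parts of decreasing rank can be inserted in
succession. -/
lemma ins_spec {x : Part} {l : List Part} (gx : x.Good) (hx : x.isSec = false)
    (hl : Admissible l) (h : l ≠ [] → x.pos < bottom l) :
    Admissible (ins x l) ∧ bottom (ins x l) = x.pos := by
  cases l with
  | nil => exact ⟨⟨gx, trivial, trivial⟩, by simp [ins, bottom, hx, front]⟩
  | cons y l =>
    have h := h (by simp)
    cases sy : y.isSec
    · have hxy := pos_lt_of_lt_bottom hl sy h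
      rw [ins]
      split_ifs with hy
      · obtain ⟨h5, h6, h7⟩ := push_spec (pushable_merge gx hx hl sy h hy.2)
        exact ⟨h5, h7.trans (merge_spec hl.1 gx sy hx hxy hy.2).2.2.2⟩
      · simp only [sy, true_and] at hy
        refine ⟨⟨gx, fitsBelow_prim sy ((sep_prim_prim gx hl.1 hx sy).2 (by omega)), hl⟩, ?_⟩
        rw [bottom] at h ⊢
        simp only [hx, sy, front, Bool.false_eq_true, if_false] at h ⊢
        cases hf : front l with
        | none => simp
        | some z =>
          simp only [hf] at h
          have h2 := pos_lt_front hl sy hf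
          have h3 := lo_lt_hi (x := z.dec) (by simpa using isSec_of_front hf)
          have h4 := hi_dec (x := z) (by omega)
          -- The front must not look as if it had climbed past `x`.
          have : ¬ z.dec.lo ≤ x.pos := by
            split_ifs at h <;> omega
          simp [this]
    · simp only [bottom, sy, if_true] at h
      have h1 := lo_lt_hi sy
      have h2 := hi_le_pos hl.1 sy
      have h3 : x.pos + 4 < y.pos := by
        have := hl.1.2.2 sy
        obtain ⟨k, c⟩ := y
        cases c <;> simp [isSec, Color.isSec] at sy <;>
          simp only [pos, lo, Color.fst, Color.snd] at h this ⊢ <;> omega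
      rw [ins, if_neg (by simp [sy])]
      refine ⟨⟨gx, ?_, hl⟩, ?_⟩
      · have h4 := (sep_prim_sec gx hl.1 hx sy).2 h3
        cases l with
        | nil => exact h4
        | cons z l => exact ⟨h4, fun _ _ _ _ => by omega⟩
      · have : ¬ y.lo ≤ x.pos := by omega
        simp [bottom, hx, front, sy, this]


lemma ins_eq {x : Part} {l : List Part} (gx : x.Good) (hx : x.isSec = false)
    (hl : Admissible l) (h : l ≠ [] → x.pos < bottom l) :
    ins x l = x :: l ∨ ∃ y t, l = y :: t ∧ y.Good ∧ y.isSec = false ∧ x.pos < y.pos ∧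
      y.pos < x.pos + 4 ∧ ins x l = push (merge y x) t ∧ Pushable (merge y x) t := by
  cases l with
  | nil => exact Or.inl rfl
  | cons y l =>
    by_cases hy : y.isSec = false ∧ y.pos < x.pos + 4
    · exact Or.inr ⟨y, l, rfl, hl.1, hy.1, pos_lt_of_lt_bottom hl hy.1 (h (by simp)), hy.2,
        by rw [ins, if_pos hy], pushable_merge gx hx hl hy.1 (h (by simp)) hy.2⟩
    · exact Or.inl (by rw [ins, if_neg hy])

lemma head_push {x : Part} {l : List Part} (h : Pushable x l) :
    ∃ y t, push x l = y :: t ∧ (y.isSec = true ∨ x.hi ≤ y.pos) := by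
  cases l with
  | nil => exact ⟨x, [], rfl, Or.inl h.isSec⟩
  | cons y l =>
    rw [push]
    split_ifs with hy
    · have := h.head y (by simp) hy.1
      have := pos_dec h.adm.1.2.1
      exact ⟨_, _, rfl, Or.inr (by omega)⟩
    · exact ⟨_, _, rfl, Or.inl h.isSec⟩

/-- After a merge the smallest part is secondary or has rank at least that of the upper half, hence
is not `x`; so the two kinds of insertion differ. Within the merging kind, `front` recovers the
merged part, whose upper half is `y`, and `pull` recovers the rest. -/
lemma ins_injective {x : Part} {l l' : List Part} (gx : x.Good) (hx : x.isSec = false)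
    (hl : Admissible l) (h : l ≠ [] → x.pos < bottom l)
    (hl' : Admissible l') (h' : l' ≠ [] → x.pos < bottom l') (heq : ins x l = ins x l') :
    l = l' := by
  have key : ∀ {y : Part} {t t' : List Part}, y.Good → y.isSec = false → x.pos < y.pos →
      y.pos < x.pos + 4 → Pushable (merge y x) t → push (merge y x) t ≠ x :: t' := by
    intro y t t' gy sy h1 h2 h3 h4
    obtain ⟨z, s, h5, h6⟩ := head_push h3
    rw [h4] at h5
    obtain ⟨rfl, -⟩ := List.cons.inj h5
    rw [(merge_spec gy gx sy hx h1 h2).2.2.1, hx] at h6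
    simp at h6
    omega
  rcases ins_eq gx hx hl h with h1 | ⟨y, t, rfl, gy, sy, h1, h2, h3, h4⟩ <;>
    rcases ins_eq gx hx hl' h' with h1' | ⟨y', t', rfl, gy', sy', h1', h2', h3', h4'⟩
  · rw [h1, h1'] at heq
    exact (List.cons.inj heq).2
  · rw [h1, h3'] at heq
    exact absurd heq.symm (key gy' sy' h1' h2' h4')
  · rw [h3, h1'] at heq
    exact absurd heq (key gy sy h1 h2 h4)
  · rw [h3, h3'] at heq
    have h5 : merge y x = merge y' x := by
      have := congrArg front heq
      rw [(push_spec h4).2.1, (push_spec h4').2.1] at this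
      exact Option.some.inj this
    have h6 : y = y' := by
      apply Part.ext_of_pos gy gy' sy sy'
      rw [← (merge_spec gy gx sy hx h1 h2).2.2.1, ← (merge_spec gy' gx sy' hx h1' h2').2.2.1, h5]
    have h7 := congrArg pull heq
    rw [pull_push h4, pull_push h4'] at h7
    rw [h6, h7]

/-! ### Inverting the insertion. -/

/-- The hypothesis `hy` says that the front part, brought back to the bottom, could really have
climbed past the smallest part. -/
lemma pull_spec {x y : Part} {l : List Part} (h : Admissible (x :: l))
    (hf : front (x :: l) = some y) (hy : x.isSec = false → y.hi ≤ x.pos) :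
    push y (pull (x :: l)) = x :: l ∧ Pushable y (pull (x :: l)) := by
  induction l generalizing x y with
  | nil =>
    cases sx : x.isSec
    · simp [front, sx] at hf
    · obtain rfl : x = y := by simpa [front, sx] using hf
      rw [pull, if_pos sx]
      exact ⟨rfl, h.1, sx, trivial, by simp, by simp [front]⟩
  | cons z l ih =>
    cases sx : x.isSec
    · have hy := hy sx
      obtain ⟨w, hw, rfl⟩ : ∃ w, front (z :: l) = some w ∧ w.dec = y := by
        rw [front, if_neg (by simp [sx])] at hf
        exact Option.map_eq_some_iff.1 hf
      have h1 := pos_lt_front h sx hw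
      have sw := isSec_of_front hw
      rw [hi_dec (by omega)] at hy
      have h2 := lo_lt_hi sw
      obtain ⟨h3, h4⟩ := ih h.2.2 hw (by
        intro sz
        have := (sep_prim_prim h.1 h.2.2.1 sx sz).1 h.2.1.sep
        omega)
      have h5 : pull (x :: z :: l) = x.inc :: pull (z :: l) := by
        rw [pull, if_neg (by simp [sx])]
      have h6 : Admissible (x.inc :: pull (z :: l)) := by
        refine ⟨h.1.inc, ?_, h4.adm⟩
        cases sz : z.isSec
        · rw [pull, if_neg (by simp [sz])]
          exact fitsBelow_prim (by simpa using sz) h.2.1.sep.inc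
        · rw [pull, if_pos sz]
          obtain rfl : z = w := by simpa [front, sz] using hw
          obtain - | ⟨u, l⟩ := l
          · trivial
          · cases su : u.isSec
            · refine fitsBelow_prim su ((sep_prim_prim h.1.inc h.2.2.2.2.1 sx su).2 ?_)
              have := (sep_sec_prim h.2.2.1 h.2.2.2.2.1 sz su).1 h.2.2.2.1.sep
              rw [pos_inc]
              omega
            · have h7 := h.2.1.2 sx sz su hy
              have h8 : Sep x.inc u := by
                rw [sep_prim_sec h.1.inc h.2.2.2.2.1 sx su, pos_inc]
                exact h7
              obtain - | ⟨v, l⟩ := l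
              · exact h8
              · refine ⟨h8, fun _ _ sv _ => ?_⟩
                have := pos_lt_of_sep_sep h.1 h.2.2.1 h.2.2.2.2.1 h.2.2.2.2.2.2.1 sx sz su sv
                  h.2.1.sep h.2.2.2.1.sep h.2.2.2.2.2.1.sep h7
                rw [pos_inc]
                omega
      rw [h5]
      constructor
      · have h7 : x.inc.pos < w.dec.pos + 4 := by
          rw [pos_inc, pos_dec (by omega)]
          exact h1.1
        rw [push, if_pos ⟨sx, h7⟩, dec_inc, inc_dec (by omega), h3]
      · refine ⟨.of_isSec (by simpa using sw) ?_, by simpa using sw, h6, ?_, ?_⟩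
        · have := h1.2.2 hy
          simp only [Part.dec]
          omega
        · intro u hu su
          obtain rfl : x.inc = u := by simpa using hu
          rw [hi_dec (by omega), pos_inc]
          omega
        · intro u hu
          obtain ⟨v, hv, rfl⟩ : ∃ v, front (pull (z :: l)) = some v ∧ v.dec = u := by
            rw [front, if_neg (by simp [sx])] at hu
            exact Option.map_eq_some_iff.1 hu
          have h7 := h4.front v hv
          have h8 := pos_lt_front h6 sx hv
          rwa [← sep_inc_inc, inc_dec (by omega), inc_dec (by omega)]
    · obtain rfl : x = y := by simpa [front, sx] using hf
      rw [pull, if_pos sx]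
      refine ⟨?_, h.1, sx, h.2.2, ?_, ?_⟩
      · rw [push, if_neg]
        rintro ⟨sz, h1⟩
        have := (sep_sec_prim h.1 h.2.2.1 sx sz).1 h.2.1.sep
        omega
      · intro u hu su
        obtain rfl : z = u := by simpa using hu
        have := (sep_sec_prim h.1 h.2.2.1 sx su).1 h.2.1.sep
        have := hi_le_pos h.1 sx
        omega
      · intro u hu
        exact sep_front h.1 sx h.2.2 (fun v hv => by
          obtain rfl : z = v := by simpa using hv
          exact h.2.1.sep) hu

/-- If the front part can be brought down past everything below it, it was merged last: it is pulled
out, its upper half goes back to the bottom, and its lower half is the inserted part. Otherwise the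
smallest part was inserted without merging. -/
lemma exists_ins_eq {l : List Part} (h : Admissible l) (hne : l ≠ []) :
    ∃ x l', x.Good ∧ x.isSec = false ∧ Admissible l' ∧ (l' ≠ [] → x.pos < bottom l') ∧
      ins x l' = l := by
  obtain - | ⟨x, l⟩ := l
  · exact absurd rfl hne
  by_cases hc : ∃ y, front (x :: l) = some y ∧ (x.isSec = false → y.hi ≤ x.pos)
  · obtain ⟨y, hy, hc⟩ := hc
    obtain ⟨h1, h2⟩ := pull_spec h hy hc
    obtain ⟨u, v, gu, gv, su, sv, hu, hv, huv⟩ := exists_merge h2.good h2.isSec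
    have h3 := lo_lt_hi h2.isSec
    have h4 : Admissible (u :: pull (x :: l)) := by
      refine ⟨gu, ?_, h2.adm⟩
      generalize pull (x :: l) = t at h2
      clear hy h1
      obtain - | ⟨z, t⟩ := t
      · trivial
      · cases sz : z.isSec
        · refine fitsBelow_prim sz ((sep_prim_prim gu h2.adm.1 su sz).2 ?_)
          rw [hu]
          exact h2.head z (by simp) sz
        · have h5 := h2.front z (by simp [front, sz])
          have h6 : Sep u z := by
            rw [sep_prim_sec gu h2.adm.1 su sz, hu]
            exact hi_lt_pos h2.good h2.adm.1 h2.isSec sz h5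
          obtain - | ⟨w, t⟩ := t
          · exact h6
          · refine ⟨h6, fun _ _ sw _ => ?_⟩
            rw [hu]
            exact hi_lt_pos_of_sep_sep h2.good h2.adm.1 h2.adm.2.2.1 h2.isSec sz sw h5
              h2.adm.2.1.sep
    refine ⟨v, u :: pull (x :: l), gv, sv, h4, fun _ => ?_, ?_⟩
    · rw [bottom, if_neg (by simp [su])]
      cases hf : front (pull (x :: l)) with
      | none => simp only; omega
      | some z =>
        have h5 := pos_lt_front h4 su hf
        have h6 := isSec_of_front hf
        have h7 := (sep_sec_sec h2.good (.of_isSec h6 h5.2.1) h2.isSec h6).1 (h2.front z hf)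
        simp only
        rw [hu, hv]
        split_ifs with h8
        · by_contra h9
          exact h7 ⟨h8, by omega⟩
        · omega
    · rw [ins, if_pos ⟨su, by omega⟩, huv, h1]
  · have sx : x.isSec = false := by
      by_contra sx
      simp only [Bool.not_eq_false] at sx
      exact hc ⟨x, by simp [front, sx], by simp [sx]⟩
    have h1 : ∀ z, front l = some z → x.pos < z.lo := by
      intro z hz
      by_contra h1
      refine hc ⟨z.dec, by simp [front, sx, hz], fun _ => ?_⟩
      rw [hi_dec (by have := pos_lt_front h sx hz; omega)]
      omega
    refine ⟨x, l, h.1, sx, h.2.2, ?_, ?_⟩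
    · intro hl
      obtain - | ⟨y, l⟩ := l
      · exact absurd rfl hl
      · cases sy : y.isSec
        · rw [bottom, if_neg (by simp [sy])]
          have h2 := (sep_prim_prim h.1 h.2.2.1 sx sy).1 h.2.1.sep
          cases hf : front l with
          | none => simp only; omega
          | some z =>
            simp only
            have h3 := h1 z.dec (by simp [front, sy, hf])
            split_ifs <;> omega
        · rw [bottom, if_pos sy]
          exact h1 y (by simp [front, sy])
    · obtain - | ⟨y, l⟩ := l
      · rfl
      · rw [ins, if_neg]
        rintro ⟨sy, h2⟩
        have h3 := (sep_prim_prim h.1 h.2.2.1 sx sy).1 h.2.1.sep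
        omega

/-! ### Insertion preserves size and colors. -/

lemma weight_cons (x : Part) (l : List Part) : weight (x :: l) = x.size + weight l := by
  simp [weight]

lemma count_cons (p : Primary) (x : Part) (l : List Part) :
    count p (x :: l) = (if p ∈ x.color.letters then 1 else 0) + count p l := by
  simp [count, List.countP_cons, add_comm]

lemma weight_push {x : Part} {l : List Part} (hl : Admissible l) :
    weight (push x l) = x.size + weight l := by
  induction l generalizing x with
  | nil => simp [push, weight]
  | cons y l ih =>
    rw [push]
    split_ifs with hy
    · rw [weight_cons, weight_cons, ih hl.2.2]
      have := hl.1.2.1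
      simp only [inc, dec]
      omega
    · rw [weight_cons]

lemma count_push (p : Primary) (x : Part) (l : List Part) :
    count p (push x l) = (if p ∈ x.color.letters then 1 else 0) + count p l := by
  induction l generalizing x with
  | nil => rw [push, count_cons]
  | cons y l ih =>
    by_cases hy : y.isSec = false ∧ y.pos < x.pos + 4
    · rw [push, if_pos hy, count_cons, count_cons, ih]
      exact add_left_comm _ _ _
    · rw [push, if_neg hy, count_cons]

lemma letters_merge (p : Primary) {x y : Part} (hx : x.Good) (hy : y.Good) (sx : x.isSec = false)
    (sy : y.isSec = false) (h : y.pos < x.pos) (h' : x.pos < y.pos + 4) :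
    (if p ∈ (merge x y).color.letters then 1 else 0) =
      (if p ∈ x.color.letters then 1 else 0) + (if p ∈ y.color.letters then 1 else 0) := by
  obtain ⟨k, c⟩ := x
  obtain ⟨m, e⟩ := y
  cases c <;> simp [isSec, Color.isSec, Good] at sx hx <;>
  cases e <;> simp [isSec, Color.isSec, Good] at sy hy <;>
  simp [pos, Color.fst] at h h' <;> first | (exfalso; omega) |
  (simp only [merge, mergeColor, Color.letters]; cases p <;> simp)

lemma Part.Good.isSec_eq {x : Part} (hx : x.Good) :
    (x.isSec = true ↔ x.color.IsSecondary) ∧ (x.isSec = false ↔ x.color.IsPrimary) := by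
  obtain ⟨k, c⟩ := x
  cases c <;> simp [isSec, Color.isSec, Good, Color.IsSecondary, Color.IsPrimary,
    Color.letters] at *

lemma weight_ins {x : Part} {l : List Part} (gx : x.Good) (hx : x.isSec = false)
    (hl : Admissible l) (h : l ≠ [] → x.pos < bottom l) :
    weight (ins x l) = x.size + weight l := by
  rcases ins_eq gx hx hl h with h1 | ⟨y, t, rfl, gy, sy, h1, h2, h3, h4⟩
  · rw [h1, weight_cons]
  · rw [h3, weight_push h4.adm, weight_cons, merge]
    simp only
    omega

lemma count_ins (p : Primary) {x : Part} {l : List Part} (gx : x.Good) (hx : x.isSec = false)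
    (hl : Admissible l) (h : l ≠ [] → x.pos < bottom l) :
    count p (ins x l) = (if p ∈ x.color.letters then 1 else 0) + count p l := by
  rcases ins_eq gx hx hl h with h1 | ⟨y, t, rfl, gy, sy, h1, h2, h3, h4⟩
  · rw [h1, count_cons]
  · rw [h3, count_push, count_cons, letters_merge p gy gx sy hx h1 h2]
    omega

/-! ### Iterated insertion as a bijection. -/

/-- Partitions into distinct primary parts, listed in increasing order. -/
def Increasing (l : List Part) : Prop :=
  (∀ x ∈ l, x.Good ∧ x.isSec = false) ∧ l.Pairwise (fun x y => x.pos < y.pos)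

/-- Insert the parts of a partition into distinct primary parts one by one, the largest first. -/
def glue (l : List Part) : List Part := l.foldr ins []

lemma Increasing.tail {x : Part} {l : List Part} (h : Increasing (x :: l)) : Increasing l :=
  ⟨fun y hy => h.1 y (List.mem_cons_of_mem _ hy), (List.pairwise_cons.1 h.2).2⟩

lemma ins_ne_nil (x : Part) (l : List Part) : ins x l ≠ [] := by
  obtain - | ⟨y, l⟩ := l
  · simp [ins]
  · rw [ins]
    split_ifs
    · obtain - | ⟨z, l⟩ := l
      · simp [push]
      · rw [push]
        split_ifs <;> simp
    · simp

lemma glue_spec {l : List Part} (h : Increasing l) :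
    Admissible (glue l) ∧ (∀ x ∈ l.head?, bottom (glue l) = x.pos) ∧ (glue l ≠ [] → l ≠ []) := by
  induction l with
  | nil => simp [glue, Admissible]
  | cons x l ih =>
    obtain ⟨h1, h2, h3⟩ := ih h.tail
    have h4 := h.1 x (by simp)
    obtain ⟨h5, h6⟩ := ins_spec h4.1 h4.2 h1 (by
      intro hne
      obtain - | ⟨y, l⟩ := l
      · exact absurd rfl (h3 hne)
      · rw [h2 y (by simp)]
        exact List.rel_of_pairwise_cons h.2 (by simp))
    refine ⟨h5, fun y hy => ?_, by simp⟩
    obtain rfl : x = y := by simpa using hy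
    exact h6

lemma lt_bottom_glue {x : Part} {l : List Part} (h : Increasing (x :: l)) :
    glue l ≠ [] → x.pos < bottom (glue l) := by
  intro hne
  obtain ⟨h1, h2, h3⟩ := glue_spec h.tail
  obtain - | ⟨y, l⟩ := l
  · exact absurd rfl (h3 hne)
  · rw [h2 y (by simp)]
    exact List.rel_of_pairwise_cons h.2 (by simp)

lemma weight_glue {l : List Part} (h : Increasing l) : weight (glue l) = weight l := by
  induction l with
  | nil => rfl
  | cons x l ih =>
    have h4 := h.1 x (by simp)
    rw [weight_cons, ← ih h.tail]
    exact weight_ins h4.1 h4.2 (glue_spec h.tail).1 (lt_bottom_glue h)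

lemma count_glue (p : Primary) {l : List Part} (h : Increasing l) :
    count p (glue l) = count p l := by
  induction l with
  | nil => rfl
  | cons x l ih =>
    have h4 := h.1 x (by simp)
    rw [count_cons, ← ih h.tail]
    exact count_ins p h4.1 h4.2 (glue_spec h.tail).1 (lt_bottom_glue h)

/-- `bottom` reveals the last inserted part, and `ins_injective` removes it. -/
lemma glue_injective {l l' : List Part} (h : Increasing l) (h' : Increasing l')
    (heq : glue l = glue l') : l = l' := by
  induction l generalizing l' with
  | nil =>
    obtain - | ⟨y, l'⟩ := l'
    · rfl
    · exact absurd heq.symm (ins_ne_nil _ _)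
  | cons x l ih =>
    obtain - | ⟨y, l'⟩ := l'
    · exact absurd heq (ins_ne_nil _ _)
    · have h1 := h.1 x (by simp)
      have h1' := h'.1 y (by simp)
      have h2 : x = y := by
        apply Part.ext_of_pos h1.1 h1'.1 h1.2 h1'.2
        rw [← (glue_spec h).2.1 x (by simp), ← (glue_spec h').2.1 y (by simp), heq]
      subst h2
      rw [ih h.tail h'.tail (ins_injective h1.1 h1.2 (glue_spec h.tail).1 (lt_bottom_glue h)
        (glue_spec h'.tail).1 (lt_bottom_glue h') heq)]

lemma exists_glue_eq {l : List Part} (h : Admissible l) : ∃ t, Increasing t ∧ glue t = l := by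
  induction hn : weight l using Nat.strong_induction_on generalizing l with
  | _ n ih =>
    by_cases hne : l = []
    · exact ⟨[], by simp [Increasing], hne.symm ▸ rfl⟩
    · obtain ⟨x, l', gx, hx, hl', hb, rfl⟩ := exists_ins_eq h hne
      obtain ⟨t, ht, rfl⟩ := ih (weight l') (by
        rw [← hn, weight_ins gx hx hl' hb]
        have := gx.2.1
        omega) hl' rfl
      refine ⟨x :: t, ⟨?_, ?_⟩, rfl⟩
      · simpa using ⟨⟨gx, hx⟩, ht.1⟩
      · have h1 : ∀ y ∈ t.head?, x.pos < y.pos := by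
          intro y hy
          rw [← (glue_spec ht).2.1 y hy]
          apply hb
          obtain - | ⟨z, t⟩ := t
          · simp at hy
          · exact ins_ne_nil _ _
        refine List.pairwise_cons.2 ⟨?_, ht.2⟩
        obtain - | ⟨z, t⟩ := t
        · simp
        · have h2 := h1 z (by simp)
          intro y hy
          rcases List.mem_cons.1 hy with rfl | hy
          · exact h2
          · exact h2.trans (List.rel_of_pairwise_cons ht.2 hy)

/-! ### Partitions into distinct primary parts as finite sets, and their generating function. -/

lemma Color.rank_injective : Function.Injective Color.rank := by
  intro x y h
  cases x <;> cases y <;> simp [Color.rank] at h ⊢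

lemma Part.le_trans {x y z : Part} (h : x.le y) (h' : y.le z) : x.le z := by
  simp only [Part.le] at *
  omega

instance : Std.Total (fun x y : Part => y.le x) where
  total x y := by
    simp only [Part.le]
    omega

instance : IsTrans Part (fun x y : Part => y.le x) where
  trans _ _ _ h h' := Part.le_trans h' h

lemma Part.le_antisymm {x y : Part} (h : x.le y) (h' : y.le x) : x = y := by
  obtain ⟨k, c⟩ := x
  obtain ⟨m, e⟩ := y
  simp only [Part.le] at h h'
  obtain rfl : c = e := Color.rank_injective (by omega)
  simp only [Part.mk.injEq, and_true]
  omega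

/-- Two partitions with the same parts are equal. -/
lemma eq_of_perm {l l' : List Part} (h : l.Pairwise (fun x y => y.le x))
    (h' : l'.Pairwise (fun x y => y.le x)) (hp : l.Perm l') : l = l' :=
  List.Perm.eq_of_pairwise (fun _ _ _ _ h1 h2 => Part.le_antisymm h2 h1) h h' hp

lemma weight_perm {l l' : List Part} (h : l.Perm l') : weight l = weight l' :=
  (h.map _).sum_eq

lemma count_perm (p : Primary) {l l' : List Part} (h : l.Perm l') : count p l = count p l' :=
  h.countP_eq _

instance : Fintype Primary where
  elems := {.a, .b, .c, .d}
  complete x := by cases x <;> decide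

/-- A primary color as a color. -/
def Primary.toColor : Primary → Color
  | a => .a | b => .b | c => .c | d => .d

lemma Primary.letters_toColor (p : Primary) : p.toColor.letters = {p} := by
  cases p <;> rfl

lemma Color.IsPrimary.exists_eq {c : Color} (h : c.IsPrimary) : ∃ p : Primary, p.toColor = c := by
  obtain ⟨p, hp⟩ := Finset.card_eq_one.1 h
  refine ⟨p, ?_⟩
  cases c <;> cases p <;> first | rfl | (exfalso; revert hp; decide)

/-- The primary part of size `k + 1` and a given color. -/
def primaryPart (i : Primary × ℕ) : Part := ⟨i.2 + 1, i.1.toColor⟩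

lemma primaryPart_injective : Function.Injective primaryPart := by
  rintro ⟨p, k⟩ ⟨r, m⟩ h
  simp only [primaryPart, Part.mk.injEq, add_left_inj] at h
  obtain ⟨rfl, h⟩ := h
  have := congrArg Color.letters h
  simpa [Primary.letters_toColor] using this

/-- The partition with a given set of primary parts. -/
noncomputable def ofFinset (s : Finset (Primary × ℕ)) : List Part :=
  (s.toList.map primaryPart).insertionSort (fun x y => y.le x)

lemma ofFinset_perm (s : Finset (Primary × ℕ)) : (ofFinset s).Perm (s.toList.map primaryPart) :=
  List.perm_insertionSort _ _

lemma ofFinset_bijOn : Set.BijOn ofFinset Set.univ {l | IsDistinctPrimary l} := by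
  refine ⟨fun s _ => ⟨⟨?_, List.pairwise_insertionSort _ _⟩, ?_, ?_⟩, ?_, ?_⟩
  · intro x hx
    obtain ⟨i, -, rfl⟩ := List.mem_map.1 ((ofFinset_perm s).mem_iff.1 hx)
    simp [primaryPart]
  · intro x hx
    obtain ⟨i, -, rfl⟩ := List.mem_map.1 ((ofFinset_perm s).mem_iff.1 hx)
    simp [primaryPart, Color.IsPrimary, Primary.letters_toColor]
  · exact (ofFinset_perm s).nodup_iff.2 (s.nodup_toList.map primaryPart_injective)
  · intro s _ t _ h
    have h1 : (s.toList.map primaryPart).Perm (t.toList.map primaryPart) :=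
      (ofFinset_perm s).symm.trans (h ▸ ofFinset_perm t)
    ext i
    rw [← Finset.mem_toList, ← Finset.mem_toList,
      ← List.mem_map_of_injective primaryPart_injective,
      ← List.mem_map_of_injective (l := t.toList) primaryPart_injective, h1.mem_iff]
  · intro l hl
    have hinj : Set.InjOn primaryPart (primaryPart ⁻¹' (l.toFinset : Set Part)) :=
      primaryPart_injective.injOn
    refine ⟨l.toFinset.preimage primaryPart hinj, trivial, ?_⟩
    apply eq_of_perm (List.pairwise_insertionSort _ _) hl.1.2
    refine (ofFinset_perm _).trans ((List.perm_ext_iff_of_nodup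
      ((Finset.nodup_toList _).map primaryPart_injective) hl.2.2).2 fun x => ?_)
    simp only [List.mem_map, Finset.mem_toList, Finset.mem_preimage, List.mem_toFinset]
    constructor
    · rintro ⟨i, hi, rfl⟩
      exact hi
    · intro hx
      obtain ⟨p, hp⟩ := (hl.2.1 x hx).exists_eq
      have : primaryPart (p, x.size - 1) = x := by
        have := hl.1.1 x hx
        obtain ⟨k, c⟩ := x
        simp only [primaryPart, Part.mk.injEq] at *
        exact ⟨by omega, hp⟩
      exact ⟨_, this ▸ hx, this⟩

/-- The numbers of parts involving `a`, `b`, `c`, `d`, and the sum of the parts. -/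
def stats (l : List Part) : ℕ × ℕ × ℕ × ℕ × ℕ :=
  (count .a l, count .b l, count .c l, count .d l, weight l)

lemma refined_eq (P : List Part → Prop) (u v w t n : ℕ) :
    refined P u v w t n = {l | P l ∧ stats l = (u, v, w, t, n)} := by
  simp [refined, stats]

/-- The total weight bounds the size of every part, so only subsets of one finite set occur. -/
lemma finite_stats_fiber (i : ℕ × ℕ × ℕ × ℕ × ℕ) : {s | stats (ofFinset s) = i}.Finite := by
  refine (Finset.finite_toSet (Finset.univ ×ˢ Finset.range i.2.2.2.2).powerset).subset ?_
  rintro s rfl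
  simp only [Finset.coe_powerset, Set.mem_preimage, Set.mem_powerset_iff, Finset.coe_subset]
  intro j hj
  simp only [Finset.mem_product, Finset.mem_univ, Finset.mem_range, true_and, stats]
  rw [weight_perm (ofFinset_perm s), weight]
  refine Nat.lt_of_succ_le (List.le_sum_of_mem (List.mem_map.2 ⟨primaryPart j, ?_, rfl⟩))
  exact List.mem_map.2 ⟨j, Finset.mem_toList.2 hj, rfl⟩

lemma stats_fiber_bijOn (u v w t n : ℕ) :
    Set.BijOn ofFinset {s | stats (ofFinset s) = (u, v, w, t, n)}
      (refined IsDistinctPrimary u v w t n) := by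
  rw [refined_eq]
  refine ⟨fun s hs => ⟨ofFinset_bijOn.1 trivial, hs⟩, ofFinset_bijOn.2.1.mono (Set.subset_univ _),
    ?_⟩
  rintro l ⟨hl, h⟩
  obtain ⟨s, -, rfl⟩ := ofFinset_bijOn.2.2 hl
  exact ⟨s, h, rfl⟩

lemma finite_refined_isDistinctPrimary (u v w t n : ℕ) :
    (refined IsDistinctPrimary u v w t n).Finite :=
  (stats_fiber_bijOn u v w t n).finite_iff_finite.1 (finite_stats_fiber _)

/-- The monomial recording the statistics of a partition. -/
def monomial (z : Primary → ℂ) (q : ℂ) (i : ℕ × ℕ × ℕ × ℕ × ℕ) : ℂ :=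
  z .a ^ i.1 * z .b ^ i.2.1 * z .c ^ i.2.2.1 * z .d ^ i.2.2.2.1 * q ^ i.2.2.2.2

lemma prod_eq_monomial (z : Primary → ℂ) (q : ℂ) (s : Finset (Primary × ℕ)) :
    ∏ i ∈ s, z i.1 * q ^ (i.2 + 1) = monomial z q (stats (ofFinset s)) := by
  have key : ∀ l : List (Primary × ℕ), (l.map fun i => z i.1 * q ^ (i.2 + 1)).prod =
      monomial z q (stats (l.map primaryPart)) := by
    intro l
    induction l with
    | nil => simp [stats, monomial, count, weight]
    | cons i l ih =>
      obtain ⟨p, k⟩ := i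
      rw [List.map_cons, List.prod_cons, ih]
      simp only [stats, monomial, List.map_cons, count_cons, weight_cons, primaryPart,
        Primary.letters_toColor, Finset.mem_singleton]
      cases p <;> simp <;> ring
  have h : stats (ofFinset s) = stats (s.toList.map primaryPart) := by
    simp only [stats, count_perm _ (ofFinset_perm s), weight_perm (ofFinset_perm s)]
  rw [h, ← key, Finset.prod_map_toList]

lemma summable_norm_mul_pow {q : ℂ} (hq : ‖q‖ < 1) (x : ℂ) : Summable fun k : ℕ => ‖x * q ^ k‖ := by
  simp only [norm_mul, norm_pow]
  exact (summable_geometric_of_lt_one (norm_nonneg _) hq).mul_left _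

lemma multipliable_one_sub_mul_pow {q : ℂ} (hq : ‖q‖ < 1) (x : ℂ) :
    Multipliable fun k : ℕ => 1 - x * q ^ k := by
  have := multipliable_one_add_of_summable (f := fun k : ℕ => -x * q ^ k)
    (summable_norm_mul_pow hq (-x))
  simpa [sub_eq_add_neg] using this

lemma summable_norm_parts (z : Primary → ℂ) {q : ℂ} (hq : ‖q‖ < 1) :
    Summable fun i : Primary × ℕ => ‖z i.1 * q ^ (i.2 + 1)‖ := by
  rw [summable_prod_of_nonneg (fun _ => norm_nonneg _)]
  refine ⟨fun p => ?_, (hasSum_fintype _).summable⟩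
  simpa [pow_succ', mul_assoc] using summable_norm_mul_pow hq (z p * q)

/-- The product of `1 + z_p q^(k+1)` over all colors and sizes expands into one term per finite set
of parts; regrouped by color it gives the four infinite products. -/
lemma hasSum_monomial_ofFinset (z : Primary → ℂ) {q : ℂ} (hq : ‖q‖ < 1) :
    HasSum (fun s => monomial z q (stats (ofFinset s)))
    (∏ p, qPoch (-(z p * q)) q) := by
  have h1 := summable_norm_parts z hq
  have h2 := (summable_finsetProd_of_summable_norm h1).hasSum
  rw [← tprod_one_add (summable_finsetProd_of_summable_norm h1),
    Multipliable.tprod_prod' (multipliable_one_add_of_summable h1), tprod_fintype] at h2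
  · simp only [prod_eq_monomial] at h2
    have h3 : ∏ p, qPoch (-(z p * q)) q = ∏ p, ∏' k : ℕ, (1 + z p * q ^ (k + 1)) :=
      Finset.prod_congr rfl fun p _ => tprod_congr fun k => by ring
    rw [h3]
    exact h2
  · intro p
    have := multipliable_one_sub_mul_pow hq (-(z p * q))
    convert this using 2
    ring

/-- The sum over finite sets is grouped by statistics; each fiber is finite and contributes its
cardinality times a single monomial. -/
lemma hasSum_distinctPrimary (z : Primary → ℂ) {q : ℂ} (hq : ‖q‖ < 1) :
    HasSum (fun i : ℕ × ℕ × ℕ × ℕ × ℕ =>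
      (A i.1 i.2.1 i.2.2.1 i.2.2.2.1 i.2.2.2.2 : ℂ) * monomial z q i)
      (∏ p, qPoch (-(z p * q)) q) := by
  refine HasSum.sigma ((Equiv.sigmaFiberEquiv fun s => stats (ofFinset s)).hasSum_iff.2
    (hasSum_monomial_ofFinset z hq)) fun i => ?_
  have hfin := finite_stats_fiber i
  have : Fintype {s // stats (ofFinset s) = i} := hfin.fintype
  convert hasSum_fintype _ using 1
  have h : ∀ c : {s // stats (ofFinset s) = i},
      ((fun s => monomial z q (stats (ofFinset s))) ∘
        (Equiv.sigmaFiberEquiv fun s => stats (ofFinset s))) ⟨i, c⟩ = monomial z q i := by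
    rintro ⟨s, rfl⟩
    rfl
  rw [Finset.sum_congr rfl fun c _ => h c, Finset.sum_const, nsmul_eq_mul, A,
    ← (stats_fiber_bijOn i.1 i.2.1 i.2.2.1 i.2.2.2.1 i.2.2.2.2).ncard_eq]
  congr 2
  rw [Finset.card_univ, ← Nat.card_eq_fintype_card]
  rfl

/-! ### Decreasing and increasing descriptions of `ℰ₁`. -/

/-- The forbidden patterns of the class `ℰ₁`. -/
def Forbidden (x y z : Part) : Prop :=
  (x.color = .cd ∧ y.color = .ab ∧ (z.color = .c ∨ z.color = .d) ∧ x.size = z.size + 2 ∧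
    y.size = z.size + 2) ∨
  (x.color = .ad ∧ y.color = .bc ∧ z.color = .a ∧ x.size = z.size + 2 ∧ y.size = z.size + 1 ∧
    z.size ≠ 1)

/-- Away from the lowered entries the gaps already add up to more than `8`. The pattern with `1_a`
is allowed because `2_bc` has lower half `1_b`, above `1_a`, so no climb past `1_a` has to be
undone. -/
lemma forbidden_iff {x y z : Part} (hx : x.Good) (hy : y.Good) (hz : z.Good) (h : Sep y x)
    (h' : Sep z y) : Forbidden x y z ↔ ¬ NoPattern z y x := by
  by_cases hs : z.isSec = false ∧ y.isSec = true ∧ x.isSec = true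
  · obtain ⟨sz, sy, sx⟩ := hs
    simp only [NoPattern, sx, sy, sz, true_implies]
    have h1 := (sep_prim_sec hz hy sz sy).1 h'
    rcases pos_le_or_of_sep hy hx sy sx h with h2 | h2 | h2
    · refine iff_of_false ?_ (by omega)
      simp only [Part.pos] at h2
      rintro (h3 | h3) <;> simp only [h3.1, h3.2.1, Color.fst] at h2 <;> omega
    all_goals
      obtain ⟨k, c⟩ := x
      obtain ⟨m, e⟩ := y
      obtain ⟨n, f⟩ := z
      obtain ⟨rfl, rfl, rfl⟩ := h2
      cases f <;> simp [isSec, Color.isSec] at sz <;>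
      simp [Forbidden, pos, lo, Color.fst, Color.snd, Good] at h1 hz ⊢ <;> omega
  · refine iff_of_false (fun h1 => hs ?_) (fun h1 => h1 fun h2 h3 h4 => absurd ⟨h2, h3, h4⟩ hs)
    simp only [isSec]
    rcases h1 with h1 | h1
    · rcases h1.2.2.1 with h2 | h2 <;> simp [h1.1, h1.2.1, h2, Color.isSec]
    · simp [h1.1, h1.2.1, h1.2.2.1, Color.isSec]

lemma admissible_iff {l : List Part} : Admissible l ↔ (∀ x ∈ l, x.Good) ∧ l.IsChain Sep ∧
    ∀ x y z, [x, y, z] <:+: l → NoPattern x y z := by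
  induction l with
  | nil => simp [Admissible]
  | cons x l ih =>
    rw [Admissible, ih]
    obtain - | ⟨y, l⟩ := l
    · simp [FitsBelow, List.infix_cons_iff]
    · obtain - | ⟨z, l⟩ := l
      · simp [FitsBelow, List.infix_cons_iff]
        tauto
      · constructor
        · rintro ⟨h1, h2, h3, h4, h5⟩
          refine ⟨by simpa using ⟨h1, by simpa using h3⟩, List.IsChain.cons_cons h2.1 h4, ?_⟩
          intro u v w h
          rcases List.infix_cons_iff.1 h with h | h
          · simp only [List.cons_prefix_cons] at h
            obtain ⟨rfl, rfl, rfl, -⟩ := h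
            exact h2.2
          · exact h5 u v w h
        · rintro ⟨h1, h2, h3⟩
          rw [List.isChain_cons_cons] at h2
          refine ⟨h1 x (by simp), ⟨h2.1, h3 _ _ _ ?_⟩,
            fun u hu => h1 u (List.mem_cons_of_mem _ hu), h2.2,
            fun u v w h => h3 u v w (List.infix_cons_iff.2 (Or.inr h))⟩
          exact List.infix_cons_iff.2 (Or.inl (by simp))

lemma Sep.le {x y : Part} (hx : x.Good) (hy : y.Good) (h : Sep x y) : x.le y := by
  obtain ⟨k, c⟩ := x
  obtain ⟨m, e⟩ := y
  cases c <;> simp [isSec, Color.isSec, Good] at hx <;>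
  cases e <;> simp [isSec, Color.isSec, Good] at hy <;>
  simp [Sep, entry, patternTable, Color.rank, Part.le] at h ⊢ <;> omega

lemma Part.good_iff {x : Part} :
    x.Good ↔ 1 ≤ x.size ∧ (x.color.IsPrimary ∨ (x.color.IsSecondary ∧ 1 < x.size)) := by
  obtain ⟨k, c⟩ := x
  cases c <;> simp [isSec, Color.isSec, Good, Color.IsSecondary, Color.IsPrimary, Color.letters]
  all_goals omega

lemma pairwise_le_of_isChain {l : List Part} (h : ∀ x ∈ l, x.Good)
    (h' : l.IsChain fun x y => Sep y x) : l.Pairwise fun x y => y.le x := by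
  induction l with
  | nil => simp
  | cons x l ih =>
    obtain - | ⟨y, l⟩ := l
    · simp
    · rw [List.isChain_cons_cons] at h'
      have h1 := ih (fun z hz => h z (List.mem_cons_of_mem _ hz)) h'.2
      refine List.pairwise_cons.2 ⟨fun z hz => ?_, h1⟩
      have h2 := h'.1.le (h y (by simp)) (h x (by simp))
      rcases List.mem_cons.1 hz with rfl | hz
      · exact h2
      · exact Part.le_trans (List.rel_of_pairwise_cons h1 hz) h2

lemma isE1_iff {l : List Part} : IsE1 l ↔ (∀ x ∈ l, x.Good) ∧ l.IsChain (fun x y => Sep y x) ∧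
    ∀ x y z, [x, y, z] <:+: l → ¬ Forbidden x y z := by
  constructor
  · rintro ⟨h1, h2, h3, h4, h5, h6⟩
    refine ⟨fun x hx => Part.good_iff.2 ⟨h1.1 x hx, h2 x hx⟩, h3, ?_⟩
    rintro ⟨i, x⟩ ⟨j, y⟩ ⟨k, z⟩ h (⟨hx, hy, hz, hi, hj⟩ | ⟨hx, hy, hz, hi, hj, hk⟩)
    · simp only at hx hy hz hi hj
      subst hx hy hi hj
      rcases hz with rfl | rfl
      · exact h4 k h
      · exact h5 k h
    · simp only at hx hy hz hi hj hk
      subst hx hy hz hi hj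
      exact h6 k hk h
  · rintro ⟨h1, h2, h3⟩
    refine ⟨⟨fun x hx => (h1 x hx).2.1, pairwise_le_of_isChain h1 h2⟩,
      fun x hx => (Part.good_iff.1 (h1 x hx)).2, h2, fun k h => h3 _ _ _ h ?_,
      fun k h => h3 _ _ _ h ?_, fun k hk h => h3 _ _ _ h ?_⟩
    · simp [Forbidden]
    · simp [Forbidden]
    · simp [Forbidden, hk]

lemma rel_of_infix {α : Type*} {R : α → α → Prop} {l : List α} (h : l.IsChain R) {x y z : α}
    (h' : [x, y, z] <:+: l) : R x y ∧ R y z := by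
  have := h.infix h'
  simpa using this

lemma isE1_iff_admissible {l : List Part} : IsE1 l ↔ Admissible l.reverse := by
  rw [isE1_iff, admissible_iff, List.isChain_reverse]
  simp only [List.mem_reverse]
  refine and_congr_right fun h1 => and_congr_right fun h2 => ?_
  constructor
  · intro h x y z hxyz
    have hxyz : [z, y, x] <:+: l := by
      rw [← List.reverse_infix]
      simpa using hxyz
    have h3 := h z y x hxyz
    have h4 := rel_of_infix h2 hxyz
    have h5 := hxyz.subset
    rw [forbidden_iff (h1 _ (h5 (by simp))) (h1 _ (h5 (by simp))) (h1 _ (h5 (by simp)))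
      h4.1 h4.2] at h3
    exact not_not.1 h3
  · intro h x y z hxyz
    have h3 := h z y x (by
      rw [← List.reverse_infix] at hxyz
      simpa using hxyz)
    have h4 := rel_of_infix h2 hxyz
    have h5 := hxyz.subset
    rw [forbidden_iff (h1 _ (h5 (by simp))) (h1 _ (h5 (by simp))) (h1 _ (h5 (by simp)))
      h4.1 h4.2]
    exact not_not.2 h3

lemma isDistinctPrimary_iff {l : List Part} : IsDistinctPrimary l ↔ Increasing l.reverse := by
  have key : ∀ {x y : Part}, x.Good → x.isSec = false → y.Good → y.isSec = false →
      (x.pos ≤ y.pos ↔ x.le y) := by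
    intro x y hx sx hy sy
    obtain ⟨k, c⟩ := x
    obtain ⟨m, e⟩ := y
    cases c <;> simp [isSec, Color.isSec, Good] at sx hx <;>
    cases e <;> simp [isSec, Color.isSec, Good] at sy hy <;>
    simp [pos, Color.fst, Color.rank, Part.le] <;> omega
  rw [Increasing, List.pairwise_reverse]
  simp only [List.mem_reverse]
  constructor
  · rintro ⟨⟨h1, h2⟩, h3, h4⟩
    have h5 : ∀ x ∈ l, x.Good ∧ x.isSec = false := by
      intro x hx
      have := Part.good_iff.2 ⟨h1 x hx, Or.inl (h3 x hx)⟩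
      exact ⟨this, this.isSec_eq.2.2 (h3 x hx)⟩
    refine ⟨h5, (h2.and h4).imp_of_mem ?_⟩
    rintro x y hx hy ⟨h6, h7⟩
    have hx := h5 x hx
    have hy := h5 y hy
    refine lt_of_le_of_ne ((key hy.1 hy.2 hx.1 hx.2).2 h6) fun h => h7 ?_
    exact Part.ext_of_pos hx.1 hy.1 hx.2 hy.2 h.symm
  · rintro ⟨h1, h2⟩
    refine ⟨⟨fun x hx => (h1 x hx).1.2.1, h2.imp_of_mem ?_⟩,
      fun x hx => (h1 x hx).1.isSec_eq.2.1 (h1 x hx).2, h2.imp ?_⟩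
    · intro x y hx hy h
      exact (key (h1 y hy).1 (h1 y hy).2 (h1 x hx).1 (h1 x hx).2).1 h.le
    · rintro x y h rfl
      exact lt_irrefl _ h

lemma glue_bijOn (u v w t n : ℕ) : Set.BijOn (fun l => (glue l.reverse).reverse)
    (refined IsDistinctPrimary u v w t n) (refined IsE1 u v w t n) := by
  have hw : ∀ l : List Part, weight l.reverse = weight l :=
    fun l => weight_perm (List.reverse_perm l)
  have hc : ∀ p, ∀ l : List Part, count p l.reverse = count p l :=
    fun p l => count_perm p (List.reverse_perm l)
  have hs : ∀ l : List Part, Increasing l.reverse → stats (glue l.reverse).reverse = stats l := by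
    intro l hl
    simp only [stats, hw, hc, weight_glue hl, count_glue _ hl]
  simp only [refined_eq]
  refine ⟨?_, ?_, ?_⟩
  · rintro l ⟨h1, h2⟩
    rw [isDistinctPrimary_iff] at h1
    refine ⟨isE1_iff_admissible.2 ?_, (hs l h1).trans h2⟩
    rw [List.reverse_reverse]
    exact (glue_spec h1).1
  · rintro l ⟨h1, -⟩ l' ⟨h1', -⟩ h
    exact List.reverse_injective (glue_injective (isDistinctPrimary_iff.1 h1)
      (isDistinctPrimary_iff.1 h1') (List.reverse_injective h))
  · rintro l ⟨h1, h2⟩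
    obtain ⟨s, h3, h4⟩ := exists_glue_eq (isE1_iff_admissible.1 h1)
    have h5 : (glue s.reverse.reverse).reverse = l := by
      rw [List.reverse_reverse, h4, List.reverse_reverse]
    have h6 : Increasing s.reverse.reverse := by rwa [List.reverse_reverse]
    exact ⟨s.reverse, ⟨isDistinctPrimary_iff.2 h6, by rw [← hs _ h6, h5, h2]⟩, h5⟩

/-! ### Inequalities between sums and remaining parts. -/

/-- The larger of the two secondary parts with sum `K` that can be replaced by `K_abcd`. -/
def upper (K : ℕ) : Part := ⟨(K + 1) / 2, if K % 2 = 0 then .cd else .ad⟩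

/-- The smaller of the two secondary parts with sum `K` that can be replaced by `K_abcd`. -/
def lower (K : ℕ) : Part := ⟨K / 2, if K % 2 = 0 then .ab else .bc⟩

/-- The minimal difference condition of `quaternaryTable` for a part `y` directly after `x`. -/
def QSep (x y : Part) : Prop := y.size + entry quaternaryTable x.color y.color ≤ x.size

/-- The part `y` can follow the pair of parts with sum `K`. -/
def CanFollow (K : ℕ) (y : Part) : Prop := Sep y (lower K) ∧ ¬ Forbidden (upper K) (lower K) y

/-- The pair of parts with sum `K` can follow the part `x`. -/
def CanPrecede (x : Part) (K : ℕ) : Prop := Sep (upper K) x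

/-- Add a number to the size of a part. -/
def Part.shift (n : ℕ) (x : Part) : Part := ⟨x.size + n, x.color⟩

lemma upper_even (k : ℕ) : upper (2 * k) = ⟨k, .cd⟩ := by
  simp [upper]; omega

lemma upper_odd (k : ℕ) : upper (2 * k + 1) = ⟨k + 1, .ad⟩ := by
  simp only [upper, Nat.mul_add_mod]; simp; omega

lemma lower_even (k : ℕ) : lower (2 * k) = ⟨k, .ab⟩ := by
  simp [lower]

lemma lower_odd (k : ℕ) : lower (2 * k + 1) = ⟨k, .bc⟩ := by
  simp [lower, Nat.add_mod]; omega

lemma even_or_odd_eq (K : ℕ) : ∃ k, K = 2 * k ∨ K = 2 * k + 1 := ⟨K / 2, by omega⟩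

/-- Twice the minimal excess of a part of the given color over half the sum of a pair below it. -/
def Color.excess : Color → ℕ
  | ab => 4 | ac => 4 | ad => 4 | c => 2 | d => 2 | _ => 3

lemma canPrecede_iff {K : ℕ} {x : Part} (hx : x.color ≠ .abcd) :
    CanPrecede x K ↔ K + x.color.excess ≤ 2 * x.size := by
  obtain ⟨n, c⟩ := x
  obtain ⟨k, rfl | rfl⟩ := even_or_odd_eq K <;>
  simp only [CanPrecede, upper_even, upper_odd, Sep] <;>
  cases c <;> simp at hx <;>
  simp [entry, patternTable, Color.rank, Color.excess] <;> omega

/-- Both the entries in the rows `ab`, `bc` and the forbidden patterns are absorbed into one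
inequality with the same color constant; the exceptional case is the allowed pattern `(3_ad, 2_bc,
1_a)`. -/
lemma canFollow_iff {K : ℕ} {x : Part} (hx : x.Good) :
    CanFollow K x ↔ 2 * x.size + 6 < K + x.color.excess ∨ K = 5 ∧ x = ⟨1, .a⟩ := by
  obtain ⟨n, c⟩ := x
  obtain ⟨k, rfl | rfl⟩ := even_or_odd_eq K <;>
  simp only [CanFollow, upper_even, upper_odd, lower_even, lower_odd, Sep, Forbidden] <;>
  cases c <;> simp [Good, isSec, Color.isSec] at hx <;>
  simp [entry, patternTable, Color.rank, Color.excess] <;> omega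

/-- Twice an entry of the table is the difference of the two color constants plus a number between
`2` and `4`. This lets separations compose with the inequalities for sums. -/
lemma excess_spec {c e : Color} (hc : c ≠ .abcd) (he : e ≠ .abcd) :
    c.excess + 2 ≤ 2 * entry quaternaryTable c e + e.excess ∧
      2 * entry quaternaryTable c e + e.excess ≤ c.excess + 4 := by
  cases c <;> simp at hc <;> cases e <;> simp at he <;>
  simp [entry, quaternaryTable, Color.rank, Color.excess]

/-- The crossing dichotomy: the two color inequalities are complementary. The exceptional case would
need `K + 2 = 5`, which `4 ≤ K` excludes. -/
lemma canPrecede_shift_iff {K : ℕ} {y : Part} (hy : y.Good) (hK : 4 ≤ K) :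
    CanPrecede (y.shift 2) K ↔ ¬ CanFollow (K + 2) y := by
  rw [canPrecede_iff (x := y.shift 2) hy.1, canFollow_iff hy]
  simp only [Part.shift]
  omega

lemma CanPrecede.mono {K K' : ℕ} {x : Part} (hx : x.color ≠ .abcd) (h : CanPrecede x K)
    (hK : K' ≤ K) : CanPrecede x K' := by
  rw [canPrecede_iff hx] at *
  omega

lemma canPrecede_shift {K : ℕ} {x : Part} (hx : x.color ≠ .abcd) :
    CanPrecede (x.shift 2) (K + 4) ↔ CanPrecede x K := by
  rw [canPrecede_iff (x := x.shift 2) hx, canPrecede_iff hx]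
  simp only [Part.shift]
  omega

lemma CanPrecede.trans {K : ℕ} {x y : Part} (hx : x.Good) (hy : y.Good) (h : QSep x y)
    (h' : CanPrecede y K) : CanPrecede x (K + 2) := by
  have := excess_spec hx.1 hy.1
  rw [canPrecede_iff hx.1]
  rw [canPrecede_iff hy.1] at h'
  simp only [QSep] at h
  omega

/-- If `K` stands between two parts, these become neighbors once `K` has crossed the left one and
lowered it by `2`; they then satisfy the stricter table. -/
lemma QSep.of_canPrecede {K : ℕ} {x y : Part} (hx : x.color ≠ .abcd) (hy : y.Good)
    (h : CanPrecede (x.shift 2) K) (h' : CanFollow K y) : QSep x y := by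
  have h1 := excess_spec hx hy.1
  rw [canPrecede_iff (x := x.shift 2) hx] at h
  rw [canFollow_iff hy] at h'
  simp only [QSep, Part.shift] at *
  rcases h' with h' | ⟨rfl, rfl⟩
  · omega
  · obtain ⟨n, c⟩ := x
    cases c <;> simp at hx <;>
    simp [entry, quaternaryTable, Color.rank, Color.excess] at h ⊢ <;> omega

lemma CanFollow.add_six_le {K K' : ℕ} {x : Part} (hx : x.Good) (h : CanFollow K x)
    (h' : CanPrecede x K') : K' + 6 ≤ K := by
  rw [canPrecede_iff hx.1] at h'
  rw [canFollow_iff hx] at h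
  rcases h with h | ⟨rfl, rfl⟩
  · omega
  · simp only [Color.excess] at h'
    omega

lemma CanFollow.six_le {K : ℕ} {x : Part} (hx : x.Good) (h : CanFollow K x) :
    6 ≤ K ∨ K = 5 ∧ x = ⟨1, .a⟩ := by
  rw [canFollow_iff hx] at h
  refine h.imp_left fun h => ?_
  obtain ⟨n, c⟩ := x
  cases c <;> simp [Good, isSec, Color.isSec, Color.excess] at hx h <;> omega

lemma canFollow_five : CanFollow 5 ⟨1, .a⟩ :=
  (canFollow_iff (by simp [Good, isSec, Color.isSec])).2 (Or.inr ⟨rfl, rfl⟩)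

lemma CanFollow.trans {K : ℕ} {x y : Part} (hx : x.Good) (hy : y.Good) (h : CanFollow (K + 2) x)
    (h' : QSep x y) (hK : 4 ≤ K) : CanFollow K y := by
  have := excess_spec hx.1 hy.1
  rw [canFollow_iff hx] at h
  rw [canFollow_iff hy]
  simp only [QSep] at h'
  omega

lemma sep_upper_lower {K K' : ℕ} : Sep (upper K') (lower K) ↔ K' + 4 ≤ K := by
  obtain ⟨k, rfl | rfl⟩ := even_or_odd_eq K <;>
  obtain ⟨k', rfl | rfl⟩ := even_or_odd_eq K' <;>
  simp [upper_even, upper_odd, lower_even, lower_odd, Sep, entry, patternTable, Color.rank] <;>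
  omega

lemma sep_lower_upper (K : ℕ) : Sep (lower K) (upper K) := by
  obtain ⟨k, rfl | rfl⟩ := even_or_odd_eq K <;>
  simp [upper_even, upper_odd, lower_even, lower_odd, Sep, entry, patternTable, Color.rank]

lemma isSummable_upper_lower (K : ℕ) : IsSummable (upper K) (lower K) := by
  obtain ⟨k, rfl | rfl⟩ := even_or_odd_eq K <;>
  simp [upper_even, upper_odd, lower_even, lower_odd, IsSummable]

lemma IsSummable.eq {x y : Part} (h : IsSummable x y) :
    upper (x.size + y.size) = x ∧ lower (x.size + y.size) = y := by
  obtain ⟨k, c⟩ := x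
  obtain ⟨m, e⟩ := y
  rcases h with ⟨rfl, rfl, h⟩ | ⟨rfl, rfl, h⟩
  · simp only at h
    rw [show k + m = 2 * m + 1 by omega, upper_odd, lower_odd, h]
    exact ⟨rfl, rfl⟩
  · simp only at h
    rw [show k + m = 2 * m by omega, upper_even, lower_even, h]
    exact ⟨rfl, rfl⟩

lemma upper_size_add_lower_size (K : ℕ) : (upper K).size + (lower K).size = K := by
  simp only [upper, lower]
  omega

lemma Part.Good.upper {K : ℕ} (hK : 4 ≤ K) : (upper K).Good := by
  obtain ⟨k, rfl | rfl⟩ := even_or_odd_eq K <;>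
  simp [upper_even, upper_odd, Good] <;> omega

lemma Part.Good.lower {K : ℕ} (hK : 4 ≤ K) : (lower K).Good := by
  obtain ⟨k, rfl | rfl⟩ := even_or_odd_eq K <;>
  simp [lower_even, lower_odd, Good] <;> omega

/-- The tables differ only in two entries, and the lowered values are attained exactly by the
summable pairs. -/
lemma qSep_iff {x y : Part} (hx : x.Good) (hy : y.Good) :
    QSep x y ↔ Sep y x ∧ ¬ IsSummable x y := by
  obtain ⟨n, c⟩ := x
  obtain ⟨m, e⟩ := y
  cases c <;> simp [Good] at hx <;> cases e <;> simp [Good] at hy <;>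
  simp [QSep, Sep, IsSummable, entry, patternTable, quaternaryTable, Color.rank] <;> omega

lemma QSep.lt {x y : Part} (hx : x.color ≠ .abcd) (hy : y.color ≠ .abcd) (h : QSep x y) :
    y.size + 1 ≤ x.size := by
  obtain ⟨n, c⟩ := x
  obtain ⟨m, e⟩ := y
  cases c <;> simp at hx <;> cases e <;> simp at hy <;>
  simp [QSep, entry, quaternaryTable, Color.rank] at h ⊢ <;> omega

lemma qSep_shift {x y : Part} (n : ℕ) : QSep (x.shift n) (y.shift n) ↔ QSep x y := by
  simp only [QSep, shift]
  omega

/-- A chain of `j` sums, each at least `4` and spaced by `4`, starts at `4 * j` or more, so `x` is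
large enough to lose `2 * j` and remain a legal part. -/
lemma CanPrecede.size {K j : ℕ} {x : Part} (hx : x.Good) (h : CanPrecede x K)
    (hK : 4 * j ≤ K) : 2 * j + (if x.isSec = true then 2 else 1) ≤ x.size := by
  rw [canPrecede_iff hx.1] at h
  obtain ⟨n, c⟩ := x
  cases c <;> simp [Good] at hx <;> simp [isSec, Color.isSec, Color.excess] at h ⊢ <;> omega

lemma Part.Good.shift {x : Part} (hx : x.Good) (n : ℕ) : (x.shift n).Good :=
  ⟨hx.1, by have := hx.2.1; simp only [Part.shift]; omega,
    fun h => by have := hx.2.2 h; simp only [Part.shift]; omega⟩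

lemma shift_shift (x : Part) (m n : ℕ) : (x.shift m).shift n = x.shift (m + n) := by
  simp [shift, add_assoc]

/-! ### Words of sums and remaining parts. -/

/-- The condition for putting the part `x` above the largest parts of a partition of `ℰ₁`. -/
def FitsAbove (x : Part) : List Part → Prop
  | [] => True
  | [y] => Sep y x
  | y :: z :: _ => Sep y x ∧ ¬ Forbidden x y z

lemma isE1_nil : IsE1 [] := isE1_iff.2 (by simp)

lemma isE1_cons {x : Part} {l : List Part} : IsE1 (x :: l) ↔ x.Good ∧ FitsAbove x l ∧ IsE1 l := by
  rw [isE1_iff, isE1_iff]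
  obtain - | ⟨y, l⟩ := l
  · simp [FitsAbove, List.infix_cons_iff]
  · obtain - | ⟨z, l⟩ := l
    · simp [FitsAbove, List.infix_cons_iff]
      tauto
    · constructor
      · rintro ⟨h1, h2, h3⟩
        rw [List.isChain_cons_cons] at h2
        refine ⟨h1 x (by simp), ⟨h2.1, h3 _ _ _ ?_⟩,
          fun u hu => h1 u (List.mem_cons_of_mem _ hu), h2.2,
          fun u v w h => h3 u v w (List.infix_cons_iff.2 (Or.inr h))⟩
        exact List.infix_cons_iff.2 (Or.inl (by simp))
      · rintro ⟨h1, h2, h3, h4, h5⟩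
        refine ⟨by simpa using ⟨h1, by simpa using h3⟩, List.IsChain.cons_cons h2.1 h4, ?_⟩
        intro u v w h
        rcases List.infix_cons_iff.1 h with h | h
        · simp only [List.cons_prefix_cons] at h
          obtain ⟨rfl, rfl, rfl, -⟩ := h
          exact h2.2
        · exact h5 u v w h

/-- A pair of consecutive parts to be replaced by its sum, or a remaining part. -/
inductive Item
  | sum (K : ℕ)
  | part (x : Part)

/-- The condition on an item. -/
def Item.Valid : Item → Prop
  | sum K => 4 ≤ K
  | part x => x.Good

/-- The condition on two consecutive items. -/
def Item.Rel : Item → Item → Prop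
  | part x, part y => QSep x y
  | part x, sum K => CanPrecede x K
  | sum K, part y => CanFollow K y
  | sum K, sum K' => K' + 4 ≤ K

/-- The partitions of `ℰ₁` with marked pairs. -/
def IsWord : List Item → Prop
  | [] => True
  | i :: W => i.Valid ∧ (∀ j ∈ W.head?, i.Rel j) ∧ IsWord W

/-- Forget the marks. -/
def flatten : List Item → List Part
  | [] => []
  | .sum K :: W => upper K :: lower K :: flatten W
  | .part x :: W => x :: flatten W

/-- The map `split` in terms of marked partitions. -/
def splitWord : List Item → List ℕ × List Part
  | [] => ([], [])
  | .sum K :: W => (K :: (splitWord W).1, (splitWord W).2)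
  | .part x :: W => ((splitWord W).1.map (· + 2),
      ⟨x.size - 2 * (splitWord W).1.length, x.color⟩ :: (splitWord W).2)

lemma upper_color (K : ℕ) : (upper K).color = .cd ∨ (upper K).color = .ad := by
  simp only [upper]
  split_ifs <;> simp

lemma lower_color (K : ℕ) : (lower K).color = .ab ∨ (lower K).color = .bc := by
  simp only [lower]
  split_ifs <;> simp

lemma not_forbidden_upper (x : Part) (K : ℕ) (z : Part) : ¬ Forbidden x (upper K) z := by
  rcases upper_color K with h | h <;> simp [Forbidden, h]

lemma not_forbidden_lower (K : ℕ) (y z : Part) : ¬ Forbidden (lower K) y z := by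
  rcases lower_color K with h | h <;> simp [Forbidden, h]

lemma not_forbidden_of_upper (x y : Part) (K : ℕ) : ¬ Forbidden x y (upper K) := by
  rcases upper_color K with h | h <;> simp [Forbidden, h]

/-- The first member of a pair is never the second member of another, so summable pairs do not
overlap. -/
lemma not_isSummable_upper (x : Part) (K : ℕ) : ¬ IsSummable x (upper K) := by
  rcases upper_color K with h | h <;> simp [IsSummable, h]

lemma Forbidden.isSummable {x y z : Part} (h : Forbidden x y z) : IsSummable x y := by
  rcases h with h | h
  · exact Or.inr ⟨h.1, h.2.1, by omega⟩
  · exact Or.inl ⟨h.1, h.2.1, by omega⟩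

lemma FitsAbove.sep {x y : Part} {l : List Part} (h : FitsAbove x (y :: l)) : Sep y x := by
  cases l with
  | nil => exact h
  | cons z l => exact h.1

lemma fitsAbove_cons {x y : Part} {l : List Part} (h : Sep y x) (h' : ∀ z, ¬ Forbidden x y z) :
    FitsAbove x (y :: l) := by
  cases l with
  | nil => exact h
  | cons z l => exact ⟨h, h' z⟩

lemma isE1_flatten {W : List Item} (h : IsWord W) : IsE1 (flatten W) := by
  induction W with
  | nil => exact isE1_nil
  | cons i W ih =>
    obtain ⟨h1, h2, h3⟩ := h
    have ih := ih h3
    cases i with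
    | part x =>
      refine isE1_cons.2 ⟨h1, ?_, ih⟩
      obtain - | ⟨j, W⟩ := W
      · trivial
      · have h2 := h2 j (by simp)
        cases j with
        | part y =>
          have h4 := (qSep_iff h1 h3.1).1 h2
          exact fitsAbove_cons h4.1 fun z hz => h4.2 hz.isSummable
        | sum K => exact fitsAbove_cons h2 fun z => not_forbidden_upper _ _ _
    | sum K =>
      refine isE1_cons.2 ⟨.upper h1, ?_, isE1_cons.2 ⟨.lower h1, ?_, ih⟩⟩
      · obtain - | ⟨j, W⟩ := W
        · exact sep_lower_upper K
        · have h2 := h2 j (by simp)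
          cases j with
          | part y => exact ⟨sep_lower_upper K, h2.2⟩
          | sum K' => exact ⟨sep_lower_upper K, not_forbidden_of_upper _ _ _⟩
      · obtain - | ⟨j, W⟩ := W
        · trivial
        · have h2 := h2 j (by simp)
          cases j with
          | part y => exact fitsAbove_cons h2.1 fun z => not_forbidden_lower _ _ _
          | sum K' => exact fitsAbove_cons (sep_upper_lower.2 h2) fun z => not_forbidden_lower _ _ _

lemma exists_flatten_eq (l : List Part) (h : IsE1 l) : ∃ W, IsWord W ∧ flatten W = l := by
  induction hn : l.length using Nat.strong_induction_on generalizing l with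
  | _ n ih =>
    obtain - | ⟨x, l⟩ := l
    · exact ⟨[], trivial, rfl⟩
    · obtain ⟨gx, hx, hl⟩ := isE1_cons.1 h
      have key : (∀ y ∈ l.head?, ¬ IsSummable x y) → ∃ W, IsWord W ∧ flatten W = x :: l := by
        intro hs
        obtain ⟨W, hW, rfl⟩ := ih l.length (by simp [← hn]) l hl rfl
        refine ⟨.part x :: W, ⟨gx, fun i hi => ?_, hW⟩, rfl⟩
        obtain - | ⟨j, W⟩ := W
        · simp at hi
        · obtain rfl : j = i := by simpa using hi
          cases j with
          | part y => exact (qSep_iff gx hW.1).2 ⟨hx.sep, hs y (by simp [flatten])⟩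
          | sum K => exact hx.sep
      obtain - | ⟨y, l⟩ := l
      · exact key (by simp)
      · by_cases hs : IsSummable x y
        · obtain ⟨gy, hy, hl'⟩ := isE1_cons.1 hl
          obtain ⟨h1, h2⟩ := hs.eq
          obtain ⟨W, hW, rfl⟩ := ih l.length (by simp [← hn]) l hl' rfl
          refine ⟨.sum (x.size + y.size) :: W, ⟨?_, fun i hi => ?_, hW⟩, by rw [flatten, h1, h2]⟩
          · have h3 : 2 ≤ x.size := gx.2.2 (by
              rcases hs with hs | hs <;> simp [Part.isSec, hs.1, Color.isSec])
            have h4 : 2 ≤ y.size := gy.2.2 (by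
              rcases hs with hs | hs <;> simp [Part.isSec, hs.2.1, Color.isSec])
            simp only [Item.Valid]
            omega
          · obtain - | ⟨j, W⟩ := W
            · simp at hi
            · obtain rfl : j = i := by simpa using hi
              cases j with
              | part z => exact ⟨h2.symm ▸ hy.sep, by rw [h1, h2]; exact hx.2⟩
              | sum K => exact sep_upper_lower.1 (h2.symm ▸ hy.sep)
        · exact key (by simpa using hs)

lemma split_flatten {W : List Item} (h : IsWord W) : split (flatten W) = splitWord W := by
  induction W with
  | nil => rfl
  | cons i W ih =>
    obtain ⟨h1, h2, h3⟩ := h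
    have ih := ih h3
    cases i with
    | sum K =>
      rw [flatten, split, if_pos (isSummable_upper_lower K), ih, upper_size_add_lower_size]
      rfl
    | part x =>
      have key : ∀ y l, flatten W = y :: l → ¬ IsSummable x y →
          split (flatten (.part x :: W)) = splitWord (.part x :: W) := by
        intro y l h4 h5
        rw [flatten, h4, split, if_neg h5, ← h4, ih]
        rfl
      obtain - | ⟨j, W⟩ := W
      · simp [flatten, split, splitWord]
      · have h2 := h2 j (by simp)
        cases j with
        | part y => exact key y _ rfl ((qSep_iff h1 h3.1).1 h2).2
        | sum K => exact key _ _ rfl (not_isSummable_upper _ _)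

/-! ### What the splitting map produces. -/

/-- The sizes of the parts with color `abcd` and the remaining parts of a quaternary partition. -/
structure IsData (Ks : List ℕ) (rs : List Part) : Prop where
  sums : Ks.IsChain (fun K K' => K' + 4 ≤ K)
  good : ∀ x ∈ rs, x.Good
  chain : rs.IsChain QSep
  bound : ∀ K ∈ Ks, 4 + 2 * rs.length ≤ K + if (⟨1, .a⟩ : Part) ∈ rs then 1 else 0

lemma four_le_of_mem_splitWord {W : List Item} (h : IsWord W) : ∀ K ∈ (splitWord W).1, 4 ≤ K := by
  induction W with
  | nil => simp [splitWord]
  | cons i W ih =>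
    have ih := ih h.2.2
    cases i with
    | sum K => simpa [splitWord] using ⟨h.1, ih⟩
    | part x =>
      intro K hK
      simp only [splitWord, List.mem_map] at hK
      obtain ⟨K', hK', rfl⟩ := hK
      have := ih K' hK'
      omega

lemma four_mul_length_le {K : ℕ} {Ks : List ℕ} (h : (K :: Ks).IsChain (fun K K' => K' + 4 ≤ K))
    (h' : ∀ L ∈ K :: Ks, 4 ≤ L) : 4 * (K :: Ks).length ≤ K := by
  induction Ks generalizing K with
  | nil => simpa using h'
  | cons L Ks ih =>
    rw [List.isChain_cons_cons] at h
    have := ih h.2 (fun M hM => h' M (List.mem_cons_of_mem _ hM))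
    simp only [List.length_cons] at *
    omega

lemma ite_mem_cons_le (x y : Part) (l : List Part) :
    (if x ∈ l then 1 else 0) ≤ if x ∈ y :: l then 1 else 0 := by
  split_ifs with h1 h2 <;> simp_all

/-- Passing from a remaining part to the next one costs `2` in the sum that can stand before it
(`CanFollow.trans`), and the last part requires `6`, or `5` if it is `1_a`. This is the origin of `4
+ 2τ - χ`. -/
lemma CanFollow.bound {K : ℕ} {y : Part} {rs : List Part} (hg : ∀ x ∈ y :: rs, x.Good)
    (hc : (y :: rs).IsChain QSep) (h : CanFollow K y) :
    4 + 2 * (y :: rs).length ≤ K + if (⟨1, .a⟩ : Part) ∈ y :: rs then 1 else 0 := by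
  induction rs generalizing K y with
  | nil =>
    rcases h.six_le (hg y (by simp)) with h1 | ⟨rfl, rfl⟩
    · simp only [List.length_cons, List.length_nil]
      omega
    · simp
  | cons z rs ih =>
    rw [List.isChain_cons_cons] at hc
    have gy := hg y (by simp)
    have gz := hg z (by simp)
    have h0 := hc.1.lt gy.1 gz.1
    have h1 : 6 ≤ K := by
      rcases h.six_le gy with h1 | ⟨rfl, rfl⟩
      · exact h1
      · have := gz.2.1
        simp only at h0
        omega
    obtain ⟨L, rfl⟩ := Nat.exists_eq_add_of_le' (show 2 ≤ K by omega)
    have h2 := ih (fun x hx => hg x (List.mem_cons_of_mem _ hx)) hc.2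
      (h.trans gy gz hc.1 (by omega))
    have h3 := ite_mem_cons_le ⟨1, .a⟩ y (z :: rs)
    simp only [List.length_cons] at *
    omega

lemma exists_shift_eq {x : Part} {n : ℕ} (hx : x.Good)
    (h : n + (if x.isSec = true then 2 else 1) ≤ x.size) : ∃ r : Part, r.Good ∧ r.shift n = x := by
  obtain ⟨k, c⟩ := x
  refine ⟨⟨k - n, c⟩, ⟨hx.1, ?_, fun h' => ?_⟩, ?_⟩
  · simp only at h ⊢
    split_ifs at h <;> omega
  · have : (⟨k, c⟩ : Part).isSec = true := h'
    rw [if_pos this] at h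
    simp only at h ⊢
    omega
  · simp only [shift, Part.mk.injEq, and_true] at *
    split_ifs at h <;> omega

lemma unshift_shift (x : Part) (n : ℕ) : (⟨(x.shift n).size - n, (x.shift n).color⟩ : Part) = x := by
  simp [shift]

/-- What `splitWord` produces, together with the relation to the first item. -/
structure SplitSpec (W : List Item) (Ks : List ℕ) (rs : List Part) : Prop extends IsData Ks rs where
  part : ∀ x, .part x ∈ W.head? → ∃ r ∈ rs.head?, x = r.shift (2 * Ks.length) ∧
    ∀ K ∈ Ks.head?, CanPrecede x (K - 2)
  sum : ∀ K, .sum K ∈ W.head? → K ∈ Ks.head? ∧ ∀ x : Part, x.Good → CanPrecede x K →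
    ∀ y ∈ rs.head?, QSep x (y.shift (2 * Ks.length))

lemma splitSpec_part {x : Part} {W : List Item} {Ks : List ℕ} {rs : List Part} (gx : x.Good)
    (h : SplitSpec W Ks rs) (h4 : ∀ K ∈ Ks, 4 ≤ K) (hW : ∀ j ∈ W.head?, (Item.part x).Rel j)
    (hnil : W = [] → Ks = [] ∧ rs = []) :
    SplitSpec (.part x :: W) (Ks.map (· + 2)) (⟨x.size - 2 * Ks.length, x.color⟩ :: rs) := by
  have hr : (∃ r : Part, r.Good ∧ r.shift (2 * Ks.length) = x) ∧
      (∀ y ∈ rs.head?, QSep x (y.shift (2 * Ks.length))) ∧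
      ∀ K ∈ Ks.head?, CanPrecede x K := by
    obtain - | ⟨j, W⟩ := W
    · obtain ⟨rfl, rfl⟩ := hnil rfl
      exact ⟨⟨x, gx, rfl⟩, by simp, by simp⟩
    · have hW := hW j (by simp)
      cases j with
      | part y =>
        obtain ⟨r, h1, rfl, h2⟩ := h.part y (by simp)
        have gr := h.good r (List.mem_of_mem_head? h1)
        have h3 : QSep x (r.shift (2 * Ks.length)) := hW
        have h5 := QSep.lt (y := r.shift _) gx.1 gr.1 h3
        refine ⟨exists_shift_eq gx ?_, fun y hy => ?_, fun K hK => ?_⟩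
        · have := gr.2.1
          simp only [shift] at h5
          split_ifs <;> omega
        · obtain rfl : y = r := Option.some_inj.1 (hy.symm.trans h1)
          exact h3
        · have h6 := (h2 K hK).trans gx (gr.shift _) h3
          have := h4 K (List.mem_of_mem_head? hK)
          rwa [Nat.sub_add_cancel (by omega)] at h6
      | sum K =>
        obtain ⟨h1, h2⟩ := h.sum K (by simp)
        have h3 : CanPrecede x K := hW
        refine ⟨exists_shift_eq gx ?_, h2 x gx h3, fun L hL => ?_⟩
        · obtain - | ⟨L, Ks⟩ := Ks
          · simp at h1
          · obtain rfl : L = K := by simpa using h1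
            exact h3.size gx (four_mul_length_le h.sums h4)
        · obtain rfl : K = L := Option.some_inj.1 (h1.symm.trans hL)
          exact h3
  obtain ⟨⟨r, gr, rfl⟩, h1, h2⟩ := hr
  rw [unshift_shift]
  refine ⟨⟨?_, ?_, ?_, ?_⟩, ?_, ?_⟩
  · rw [List.isChain_map]
    exact h.sums.imp fun K K' hK => by omega
  · simpa using ⟨gr, h.good⟩
  · refine List.isChain_cons.2 ⟨fun y hy => ?_, h.chain⟩
    exact (qSep_shift _).1 (h1 y hy)
  · intro K hK
    obtain ⟨L, hL, rfl⟩ := List.mem_map.1 hK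
    have := h.bound L hL
    have := ite_mem_cons_le ⟨1, .a⟩ r rs
    simp only [List.length_cons]
    omega
  · intro y hy
    obtain rfl : r.shift (2 * Ks.length) = y := by simpa using hy
    refine ⟨r, by simp, by simp, fun K hK => ?_⟩
    rw [List.head?_map] at hK
    obtain ⟨L, hL, rfl⟩ := Option.map_eq_some_iff.1 hK
    exact h2 L hL
  · intro K hK
    simp at hK

lemma splitSpec_sum {K : ℕ} {W : List Item} {Ks : List ℕ} {rs : List Part} (hK : 4 ≤ K)
    (h : SplitSpec W Ks rs) (h4 : ∀ K ∈ Ks, 4 ≤ K) (hW : ∀ j ∈ W.head?, (Item.sum K).Rel j)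
    (hnil : W = [] → Ks = [] ∧ rs = []) : SplitSpec (.sum K :: W) (K :: Ks) rs := by
  have h1 : ∀ L ∈ Ks.head?, L + 4 ≤ K := by
    intro L hL
    obtain - | ⟨j, W⟩ := W
    · simp [(hnil rfl).1] at hL
    · have hW := hW j (by simp)
      cases j with
      | part y =>
        obtain ⟨r, h1, rfl, h2⟩ := h.part y (by simp)
        have gr := h.good r (List.mem_of_mem_head? h1)
        -- The leading sum `L` counts here as `L - 2`, its value before crossing the part that now
        -- leads, so a gap of `6` becomes `4`.
        have := CanFollow.add_six_le (gr.shift _) hW (h2 L hL)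
        omega
      | sum M =>
        obtain rfl : M = L := Option.some_inj.1 ((h.sum M (by simp)).1.symm.trans hL)
        exact hW
  refine ⟨⟨List.isChain_cons.2 ⟨h1, h.sums⟩, h.good, h.chain, ?_⟩, by simp, ?_⟩
  · intro L hL
    rcases List.mem_cons.1 hL with rfl | hL
    · obtain - | ⟨M, Ks⟩ := Ks
      · obtain - | ⟨j, W⟩ := W
        · simpa [(hnil rfl).2] using hK
        · have hW := hW j (by simp)
          cases j with
          | part y =>
            obtain ⟨r, h1, rfl, h2⟩ := h.part y (by simp)
            obtain - | ⟨r', rs⟩ := rs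
            · simp at h1
            · obtain rfl : r' = r := by simpa using h1
              exact CanFollow.bound h.good h.chain hW
          | sum M => simpa using (h.sum M (by simp)).1
      · have := h1 M (by simp)
        have := h.bound M (by simp)
        omega
    · exact h.bound L hL
  · intro L hL
    obtain rfl : K = L := by simpa using hL
    refine ⟨by simp, fun x gx hx y hy => ?_⟩
    -- The part before `K` is lowered by `2` as `K` crosses it, so the claim is proved for the
    -- lowered part and then shifted back.
    obtain ⟨x, gx', rfl⟩ := exists_shift_eq (n := 2) gx (by
      simpa using hx.size (j := 1) gx (by omega))
    have h5 : QSep x (y.shift (2 * Ks.length)) := by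
      obtain - | ⟨j, W⟩ := W
      · simp [(hnil rfl).2] at hy
      · have hW := hW j (by simp)
        cases j with
        | part z =>
          obtain ⟨r, h1, rfl, h2⟩ := h.part z (by simp)
          obtain rfl : y = r := Option.some_inj.1 (hy.symm.trans h1)
          exact QSep.of_canPrecede gx'.1 ((h.good y (List.mem_of_mem_head? hy)).shift _) hx hW
        | sum M =>
          have hM : M + 4 ≤ K := hW
          exact (h.sum M (by simp)).2 x gx' ((canPrecede_shift gx'.1).1 (hx.mono gx.1 hM)) y hy
    rwa [← qSep_shift 2, shift_shift] at h5

lemma splitWord_spec {W : List Item} (h : IsWord W) :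
    SplitSpec W (splitWord W).1 (splitWord W).2 := by
  induction W with
  | nil => exact ⟨⟨by simp [splitWord], by simp [splitWord], by simp [splitWord],
      by simp [splitWord]⟩, by simp, by simp⟩
  | cons i W ih =>
    have ih := ih h.2.2
    have h4 := four_le_of_mem_splitWord h.2.2
    cases i with
    | part x => exact splitSpec_part h.1 ih h4 h.2.1 (by rintro rfl; exact ⟨rfl, rfl⟩)
    | sum K => exact splitSpec_sum h.1 ih h4 h.2.1 (by rintro rfl; exact ⟨rfl, rfl⟩)

/-! ### The splitting map is a bijection. -/

/-- If the word started with the first remaining part instead, that part would have been lowered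
once for every sum, `K` included, and would have to precede `K - 2`. The dichotomy forbids this,
except when the sum `5` occurs; crossed sums are at least `6`, so a word starting with a part never
yields `5`. -/
lemma not_canPrecede_of_sum {K : ℕ} {W : List Item} {r : Part} (h : IsWord (.sum K :: W))
    (hr : r ∈ (splitWord W).2.head?) : 5 ∈ K :: (splitWord W).1 ∨
      ¬ CanPrecede (r.shift (2 * (splitWord W).1.length + 2)) (K - 2) := by
  induction W generalizing K with
  | nil => simp [splitWord] at hr
  | cons j W ih =>
    have hW := h.2.1 j (by simp)
    have hs := splitWord_spec h.2.2
    cases j with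
    | part y =>
      obtain ⟨r', h1, hy, h2⟩ := hs.part y (by simp)
      obtain rfl : r = r' := Option.some_inj.1 (hr.symm.trans h1)
      have gr := hs.good r (List.mem_of_mem_head? hr)
      have hf : CanFollow K y := hW
      rw [hy] at hf
      rcases hf.six_le (gr.shift _) with h3 | ⟨rfl, -⟩
      · right
        obtain ⟨L, rfl⟩ := Nat.exists_eq_add_of_le' (show 2 ≤ K by omega)
        rw [← shift_shift, Nat.add_sub_cancel, canPrecede_shift_iff (gr.shift _) (by omega),
          not_not]
        exact hf
      · simp
    | sum L =>
      have hKL : L + 4 ≤ K := hW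
      have hL : 4 ≤ L := h.2.2.1
      have gr := hs.good r (List.mem_of_mem_head? hr)
      rcases ih h.2.2 hr with h1 | h1
      · exact Or.inl (List.mem_cons_of_mem _ h1)
      · refine Or.inr fun h2 => h1 ?_
        have h3 : CanPrecede (r.shift (2 * (splitWord W).1.length + 2 + 2)) (L - 2 + 4) := by
          refine CanPrecede.mono (gr.shift _).1 h2 (by omega)
        rw [← shift_shift] at h3
        exact (canPrecede_shift (x := r.shift _) (gr.shift _).1).1 h3

lemma splitWord_sum_ne_part {K : ℕ} {x : Part} {W W' : List Item} (h : IsWord (.sum K :: W))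
    (h' : IsWord (.part x :: W')) : splitWord (.sum K :: W) ≠ splitWord (.part x :: W') := by
  intro heq
  obtain ⟨r, h1, hx, h2⟩ := (splitWord_spec h').part x (by simp)
  have h4 := four_le_of_mem_splitWord h'.2.2
  have h5 : 5 ∉ (splitWord (.part x :: W')).1 := by
    intro h5
    simp only [splitWord, List.mem_map] at h5
    obtain ⟨L, hL, h6⟩ := h5
    have := h4 L hL
    omega
  rw [← heq] at h1 h2 h5 hx
  rcases not_canPrecede_of_sum h h1 with h6 | h6
  · exact h5 h6
  · apply h6
    have := h2 K (by simp [splitWord])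
    rw [hx] at this
    exact this

lemma splitWord_injective {W W' : List Item} (h : IsWord W) (h' : IsWord W')
    (heq : splitWord W = splitWord W') : W = W' := by
  induction W generalizing W' with
  | nil =>
    obtain - | ⟨j, W'⟩ := W'
    · rfl
    · cases j <;> simp [splitWord] at heq
  | cons i W ih =>
    obtain - | ⟨j, W'⟩ := W'
    · cases i <;> simp [splitWord] at heq
    · cases i with
      | sum K =>
        cases j with
        | sum L =>
          simp only [splitWord, Prod.mk.injEq, List.cons.injEq] at heq
          rw [heq.1.1, ih h.2.2 h'.2.2 (Prod.ext heq.1.2 heq.2)]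
        | part y => exact absurd heq (splitWord_sum_ne_part h h')
      | part x =>
        cases j with
        | sum L => exact absurd heq.symm (splitWord_sum_ne_part h' h)
        | part y =>
          obtain ⟨r, h1, hx, -⟩ := (splitWord_spec h).part x (by simp)
          obtain ⟨r', h1', hx', -⟩ := (splitWord_spec h').part y (by simp)
          rw [heq] at h1 hx
          obtain rfl : r = r' := Option.some_inj.1 (h1.symm.trans h1')
          simp only [splitWord, Prod.mk.injEq, List.cons.injEq] at heq
          have h2 : (splitWord W).1 = (splitWord W').1 :=
            List.map_injective_iff.2 (add_left_injective 2) heq.1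
          rw [hx.trans hx'.symm, ih h.2.2 h'.2.2 (Prod.ext h2 heq.2.2)]

lemma isWord_sums {Ks : List ℕ} (h : Ks.IsChain (fun K K' => K' + 4 ≤ K)) (h4 : ∀ K ∈ Ks, 4 ≤ K) :
    IsWord (Ks.map .sum) ∧ splitWord (Ks.map .sum) = (Ks, []) := by
  induction Ks with
  | nil => exact ⟨trivial, rfl⟩
  | cons K Ks ih =>
    rw [List.isChain_cons] at h
    obtain ⟨h1, h2⟩ := ih h.2 fun L hL => h4 L (List.mem_cons_of_mem _ hL)
    refine ⟨⟨h4 K (by simp), ?_, h1⟩, by simp [splitWord, h2]⟩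
    intro j hj
    rw [List.head?_map] at hj
    obtain ⟨L, hL, rfl⟩ := Option.map_eq_some_iff.1 hj
    exact h.1 L hL

/-- The leading sum `K` is put in front of the word built from everything else if the order allows
it. If not, the dichotomy allows the first remaining part, raised by `2` per sum, to stand in front
of a word whose sums are all lowered by `2`. -/
lemma exists_splitWord_eq (n : ℕ) {Ks : List ℕ} {rs : List Part} (hn : Ks.length + rs.length = n)
    (h : IsData Ks rs) : ∃ W, IsWord W ∧ splitWord W = (Ks, rs) := by
  induction n using Nat.strong_induction_on generalizing Ks rs with
  | _ n ih =>
    obtain - | ⟨r, rs⟩ := rs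
    · refine ⟨_, isWord_sums h.sums fun K hK => ?_⟩
      simpa using h.bound K hK
    have gr := h.good r (by simp)
    have hchain := List.isChain_cons.1 h.chain
    have hgood : ∀ x ∈ rs, x.Good := fun x hx => h.good x (List.mem_cons_of_mem _ hx)
    obtain - | ⟨K, Ks⟩ := Ks
    · obtain ⟨W, hW, h1⟩ := ih rs.length (by simp at hn; omega) (Ks := []) (rs := rs) (by simp)
        ⟨by simp, hgood, hchain.2, by simp⟩
      have hs := splitWord_spec hW
      refine ⟨.part r :: W, ⟨gr, fun j hj => ?_, hW⟩, by simp [splitWord, h1]⟩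
      rw [h1] at hs
      cases j with
      | part y =>
        obtain ⟨r', h2, rfl, -⟩ := hs.part y hj
        exact hchain.1 r' h2
      | sum K => simpa using (hs.sum K hj).1
    · have hsums := List.isChain_cons.1 h.sums
      have hK := h.bound K (by simp)
      obtain ⟨W, hW, h1⟩ := ih (Ks.length + (r :: rs).length) (by simp at hn ⊢; omega) rfl
        ⟨hsums.2, h.good, h.chain, fun L hL => h.bound L (List.mem_cons_of_mem _ hL)⟩
      have hs := splitWord_spec hW
      by_cases hrel : ∀ j ∈ W.head?, (Item.sum K).Rel j
      · refine ⟨.sum K :: W, ⟨?_, hrel, hW⟩, by simp [splitWord, h1]⟩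
        simp only [Item.Valid, List.length_cons] at hK ⊢
        split_ifs at hK <;> omega
      · obtain - | ⟨j, W⟩ := W
        · simp at hrel
        have hrel : ¬ (Item.sum K).Rel j := by simpa using hrel
        rw [h1] at hs
        cases j with
        | sum L =>
          exact absurd (hsums.1 L (hs.sum L (by simp)).1) hrel
        | part x =>
          obtain ⟨r', h2, rfl, h3⟩ := hs.part x (by simp)
          obtain rfl : r = r' := by simpa using h2
          have hf : ¬ CanFollow K (r.shift (2 * Ks.length)) := hrel
          -- The later sums have already crossed `r`, hence are at least `6`. If `K` is the only sum
          -- and smaller, the bound forces `r = 1_a` and `K = 5`, an order that is allowed.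
          have h6 : ∀ L ∈ K :: Ks, 6 ≤ L := by
            have h7 : ∀ L ∈ Ks, 6 ≤ L := by
              intro L hL
              have h8 := congrArg Prod.fst h1
              simp only [splitWord] at h8
              rw [← h8] at hL
              obtain ⟨M, hM, rfl⟩ := List.mem_map.1 hL
              have := four_le_of_mem_splitWord hW.2.2 M hM
              omega
            have h8 : 6 ≤ K := by
              obtain - | ⟨L, Ks⟩ := Ks
              · by_contra hlt
                have hr : r = ⟨1, .a⟩ := by
                  obtain - | ⟨s, rs⟩ := rs
                  · split_ifs at hK with hm
                    · exact (List.mem_singleton.1 hm).symm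
                    · simp at hK; omega
                  · simp only [List.length_cons] at hK
                    split_ifs at hK <;> omega
                subst hr
                have : K = 5 := by
                  simp only [List.length_cons] at hK
                  split_ifs at hK <;> omega
                subst this
                exact hf canFollow_five
              · have := hsums.1 L (by simp)
                have := h7 L (by simp)
                omega
            simpa using ⟨h8, h7⟩
          -- Removing `r` lowers the bound by `2`, as it does the sums. The term `χ` is lost only if
          -- `r = 1_a`, and then nothing remains below `r`.
          have hdata : IsData ((K :: Ks).map (· - 2)) rs := by
            refine ⟨?_, hgood, hchain.2, ?_⟩
            · rw [List.isChain_map]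
              refine h.sums.imp_of_mem_imp fun L M hL hM hLM => ?_
              have := h6 M hM
              omega
            · intro L hL
              obtain ⟨M, hM, rfl⟩ := List.mem_map.1 hL
              have h7 := h.bound M hM
              have h8 := h6 M hM
              by_cases hr : r = ⟨1, .a⟩
              · obtain - | ⟨s, rs⟩ := rs
                · simp; omega
                · have h9 := (hchain.1 s (by simp)).lt gr.1 (hgood s (by simp)).1
                  have := (hgood s (by simp)).2.1
                  rw [hr] at h9
                  simp only at h9
                  omega
              · have h9 : (⟨1, .a⟩ : Part) ∈ r :: rs ↔ (⟨1, .a⟩ : Part) ∈ rs := by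
                  simp [Ne.symm hr]
                simp only [h9, List.length_cons] at h7
                omega
          obtain ⟨V, hV, h7⟩ := ih ((K :: Ks).length + rs.length) (by simp at hn ⊢; omega)
            (by simp) hdata
          have ht := splitWord_spec hV
          rw [h7] at ht
          refine ⟨.part (r.shift (2 * (K :: Ks).length)) :: V, ⟨gr.shift _, ?_, hV⟩, ?_⟩
          · intro j hj
            cases j with
            | part y =>
              obtain ⟨s, h8, rfl, -⟩ := ht.part y hj
              rw [List.length_map]
              exact (qSep_shift _).2 (hchain.1 s h8)
            | sum L =>
              have h8 := (ht.sum L hj).1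
              obtain rfl : K - 2 = L := by simpa using h8
              have h9 := h6 K (by simp)
              change CanPrecede _ _
              rw [show 2 * (K :: Ks).length = 2 * Ks.length + 2 by simp; ring, ← shift_shift,
                canPrecede_shift_iff (gr.shift _) (by omega), Nat.sub_add_cancel (by omega)]
              exact hf
          · rw [splitWord, h7]
            simp only [List.length_map, unshift_shift, List.map_map]
            congr 1
            conv_rhs => rw [← List.map_id (K :: Ks)]
            refine List.map_congr_left fun L hL => ?_
            have := h6 L hL
            simp only [Function.comp_apply, id_eq]
            omega

/-! ### From words to quaternary partitions. -/

/-- The parts of a quaternary partition, in the order in which `toQuaternary` collects them. -/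
def collect (s : List ℕ × List Part) : List Part := s.1.map (fun K => ⟨K, .abcd⟩) ++ s.2

lemma toQuaternary_perm (l : List Part) : (toQuaternary l).Perm (collect (split l)) :=
  List.perm_insertionSort _ _

lemma weight_collect_eq (s : List ℕ × List Part) : weight (collect s) = s.1.sum + weight s.2 := by
  simp [collect, weight, Function.comp_def]

lemma count_collect_eq (p : Primary) (s : List ℕ × List Part) :
    count p (collect s) = s.1.length + count p s.2 := by
  have h : p ∈ Color.letters .abcd := by cases p <;> decide
  simp [collect, count, List.countP_map, Function.comp_def, h]

lemma sum_map_add_two (l : List ℕ) : (l.map (· + 2)).sum = l.sum + 2 * l.length := by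
  induction l with
  | nil => rfl
  | cons n l ih =>
    simp only [List.map_cons, List.sum_cons, List.length_cons, ih]
    ring

lemma weight_collect {W : List Item} (h : IsWord W) :
    weight (collect (splitWord W)) = weight (flatten W) := by
  rw [weight_collect_eq]
  induction W with
  | nil => rfl
  | cons i W ih =>
    have ih := ih h.2.2
    cases i with
    | sum K =>
      have := upper_size_add_lower_size K
      simp only [splitWord, flatten, weight_cons, List.sum_cons]
      omega
    | part x =>
      obtain ⟨r, -, hx, -⟩ := (splitWord_spec h).part x (by simp)
      have h1 : 2 * (splitWord W).1.length ≤ x.size := by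
        have := congrArg Part.size hx
        simp only [shift, splitWord, List.length_map] at this
        omega
      simp only [splitWord, flatten, weight_cons, sum_map_add_two]
      omega

lemma count_collect (p : Primary) (W : List Item) :
    count p (collect (splitWord W)) = count p (flatten W) := by
  rw [count_collect_eq]
  induction W with
  | nil => rfl
  | cons i W ih =>
    cases i with
    | sum K =>
      have h : (if p ∈ (upper K).color.letters then 1 else 0) +
          (if p ∈ (lower K).color.letters then 1 else 0) = 1 := by
        simp only [upper, lower]
        by_cases hK : K % 2 = 0
        · simp only [hK, if_true, Color.letters]
          cases p <;> decide
        · simp only [hK, if_false, Color.letters]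
          cases p <;> decide
      simp only [splitWord, flatten, count_cons, List.length_cons]
      omega
    | part x =>
      simp only [splitWord, flatten, count_cons, List.length_map]
      omega

lemma isQuaternary_iff {l : List Part} :
    IsQuaternary l ↔ IsPartition l ∧ IsData ((quaternaryParts l).map Part.size) (ordinaryParts l) := by
  have hmem : (⟨1, .a⟩ : Part) ∈ ordinaryParts l ↔ (⟨1, .a⟩ : Part) ∈ l := by
    simp [ordinaryParts]
  have hsec : ∀ x : Part, x.isSec = true ↔ x.color.IsSecondary := by
    rintro ⟨k, c⟩
    cases c <;> simp [isSec, Color.isSec, Color.IsSecondary, Color.letters]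
  constructor
  · rintro ⟨h1, h2, h3, h4, h5⟩
    refine ⟨h1, by rwa [List.isChain_map], fun x hx => ?_, h3, fun K hK => ?_⟩
    · simp only [ordinaryParts, List.mem_filter, decide_eq_true_eq] at hx
      exact ⟨hx.2, h1.1 x hx.1, fun h => h2 x hx.1 ((hsec x).1 h)⟩
    · obtain ⟨x, hx, rfl⟩ := List.mem_map.1 hK
      simp only [hmem]
      exact h5 x hx
  · rintro ⟨h1, h2⟩
    refine ⟨h1, fun x hx h => ?_, h2.chain, by simpa [List.isChain_map] using h2.sums,
      fun x hx => ?_⟩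
    · have hx' : x ∈ ordinaryParts l := by
        simp only [ordinaryParts, List.mem_filter, decide_eq_true_eq]
        refine ⟨hx, fun h' => ?_⟩
        simp [h', Color.IsSecondary, Color.letters] at h
      exact (h2.good x hx').2.2 ((hsec x).2 h)
    · have := h2.bound x.size (List.mem_map_of_mem hx)
      simpa only [hmem] using this

/-- Sums and remaining parts are each already non-increasing, so sorting them together changes
neither subsequence. -/
lemma parts_of_perm_collect {Ks : List ℕ} {rs l : List Part} (h : IsData Ks rs)
    (hl : l.Pairwise fun x y => y.le x) (hp : l.Perm (collect (Ks, rs))) :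
    (quaternaryParts l).map Part.size = Ks ∧ ordinaryParts l = rs := by
  have h1 : ∀ x ∈ rs, x.color ≠ .abcd := fun x hx => (h.good x hx).1
  constructor
  · have h2 : quaternaryParts l = Ks.map fun K => ⟨K, .abcd⟩ := by
      apply eq_of_perm (hl.filter _)
      · have : Ks.Pairwise fun K K' => K' ≤ K := by
          have := h.sums.imp (S := fun K K' => K ≥ K') fun K K' hK => by omega
          exact List.isChain_iff_pairwise.1 this
        refine List.pairwise_map.2 (this.imp fun hK => ?_)
        rcases hK.lt_or_eq with hK | hK
        · exact Or.inl hK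
        · exact Or.inr ⟨hK, le_rfl⟩
      · refine (hp.filter _).trans (List.Perm.of_eq ?_)
        rw [collect, List.filter_append, List.filter_eq_self.2, List.filter_eq_nil_iff.2,
          List.append_nil]
        · simpa using h1
        · simp
    rw [h2, List.map_map]
    exact List.map_id _
  · apply eq_of_perm (hl.filter _)
    · refine pairwise_le_of_isChain h.good (h.chain.imp_of_mem_imp fun x y hx hy hxy => ?_)
      exact ((qSep_iff (h.good x hx) (h.good y hy)).1 hxy).1
    · refine (hp.filter _).trans (List.Perm.of_eq ?_)
      rw [collect, List.filter_append, List.filter_eq_nil_iff.2, List.filter_eq_self.2,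
        List.nil_append]
      · simpa using h1
      · simp

lemma collect_parts_perm (l : List Part) :
    (collect ((quaternaryParts l).map Part.size, ordinaryParts l)).Perm l := by
  have h : ((quaternaryParts l).map Part.size).map (fun K => (⟨K, .abcd⟩ : Part)) =
      quaternaryParts l := by
    rw [List.map_map]
    conv_rhs => rw [← List.map_id (quaternaryParts l)]
    refine List.map_congr_left fun x hx => ?_
    simp only [quaternaryParts, List.mem_filter, decide_eq_true_eq] at hx
    obtain ⟨k, c⟩ := x
    simp only at hx
    simp [hx.2]
  rw [collect, h, quaternaryParts, ordinaryParts]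
  convert List.filter_append_perm (fun x : Part => decide (x.color = .abcd)) l using 3
  simp

lemma toQuaternary_flatten {W : List Item} (h : IsWord W) :
    (quaternaryParts (toQuaternary (flatten W))).map Part.size = (splitWord W).1 ∧
      ordinaryParts (toQuaternary (flatten W)) = (splitWord W).2 := by
  apply parts_of_perm_collect (splitWord_spec h).toIsData (List.pairwise_insertionSort _ _)
  rw [← split_flatten h]
  exact toQuaternary_perm _

lemma toQuaternary_bijOn : Set.BijOn toQuaternary {l | IsE1 l} {l | IsQuaternary l} := by
  refine ⟨?_, ?_, ?_⟩
  · intro l hl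
    obtain ⟨W, hW, rfl⟩ := exists_flatten_eq l hl
    obtain ⟨h1, h2⟩ := toQuaternary_flatten hW
    refine isQuaternary_iff.2 ⟨⟨fun x hx => ?_, List.pairwise_insertionSort _ _⟩, ?_⟩
    · rw [(toQuaternary_perm _).mem_iff, split_flatten hW, collect, List.mem_append,
        List.mem_map] at hx
      rcases hx with ⟨K, hK, rfl⟩ | hx
      · have := four_le_of_mem_splitWord hW K hK
        simp only
        omega
      · exact ((splitWord_spec hW).good x hx).2.1
    · rw [h1, h2]
      exact (splitWord_spec hW).toIsData
  · intro l hl l' hl' h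
    obtain ⟨W, hW, rfl⟩ := exists_flatten_eq l hl
    obtain ⟨W', hW', rfl⟩ := exists_flatten_eq l' hl'
    obtain ⟨h1, h2⟩ := toQuaternary_flatten hW
    obtain ⟨h1', h2'⟩ := toQuaternary_flatten hW'
    rw [h] at h1 h2
    rw [splitWord_injective hW hW' (Prod.ext (h1.symm.trans h1') (h2.symm.trans h2'))]
  · intro l hl
    obtain ⟨h1, h2⟩ := isQuaternary_iff.1 hl
    obtain ⟨W, hW, h3⟩ := exists_splitWord_eq _ rfl h2
    refine ⟨flatten W, isE1_flatten hW, ?_⟩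
    apply eq_of_perm (List.pairwise_insertionSort _ _) h1.2
    refine (toQuaternary_perm _).trans ?_
    rw [split_flatten hW, h3]
    exact collect_parts_perm l

lemma weight_toQuaternary {l : List Part} (h : IsE1 l) : weight (toQuaternary l) = weight l := by
  obtain ⟨W, hW, rfl⟩ := exists_flatten_eq l h
  rw [weight_perm (toQuaternary_perm _), split_flatten hW, weight_collect hW]

lemma count_toQuaternary (p : Primary) {l : List Part} (h : IsE1 l) :
    count p (toQuaternary l) = count p l := by
  obtain ⟨W, hW, rfl⟩ := exists_flatten_eq l h
  rw [count_perm p (toQuaternary_perm _), split_flatten hW, count_collect]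

lemma toQuaternary_bijOn_refined (u v w t n : ℕ) :
    Set.BijOn toQuaternary (refined IsE1 u v w t n) (refined IsQuaternary u v w t n) := by
  have hs : ∀ l, IsE1 l → stats (toQuaternary l) = stats l := by
    intro l hl
    simp only [stats, weight_toQuaternary hl, count_toQuaternary _ hl]
  simp only [refined_eq]
  refine ⟨?_, fun l hl l' hl' h => toQuaternary_bijOn.2.1 hl.1 hl'.1 h, ?_⟩
  · rintro l ⟨h1, h2⟩
    exact ⟨toQuaternary_bijOn.1 h1, (hs l h1).trans h2⟩
  · rintro l ⟨h1, h2⟩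
    obtain ⟨l', h3, rfl⟩ := toQuaternary_bijOn.2.2 h1
    exact ⟨l', ⟨h3, (hs l' h3).symm.trans h2⟩, rfl⟩

lemma A_eq_B (u v w t n : ℕ) : A u v w t n = B u v w t n :=
  (glue_bijOn u v w t n).ncard_eq.trans (toQuaternary_bijOn_refined u v w t n).ncard_eq

end AAB

theorem theorem1p4 :
    (∀ u v w t n : ℕ,
      (AAB.refined AAB.IsDistinctPrimary u v w t n).Finite ∧
      (AAB.refined AAB.IsQuaternary u v w t n).Finite ∧
      AAB.A u v w t n = AAB.B u v w t n) ∧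
    (∀ a b c d q : ℂ, ‖q‖ < 1 →
      (∀ x : ℂ, Multipliable (fun k : ℕ => 1 - x * q ^ k)) ∧
      HasSum
        (fun i : ℕ × ℕ × ℕ × ℕ × ℕ =>
          (AAB.B i.1 i.2.1 i.2.2.1 i.2.2.2.1 i.2.2.2.2 : ℂ) *
            a ^ i.1 * b ^ i.2.1 * c ^ i.2.2.1 * d ^ i.2.2.2.1 * q ^ i.2.2.2.2)
        (AAB.qPoch (-(a * q)) q * AAB.qPoch (-(b * q)) q *
          AAB.qPoch (-(c * q)) q * AAB.qPoch (-(d * q)) q)) ∧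
    Set.BijOn AAB.toQuaternary {l | AAB.IsE1 l} {l | AAB.IsQuaternary l} ∧
    (∀ l : List AAB.Part, AAB.IsE1 l →
      AAB.weight (AAB.toQuaternary l) = AAB.weight l ∧
      ∀ p : AAB.Primary, AAB.count p (AAB.toQuaternary l) = AAB.count p l) := by
  refine ⟨fun u v w t n => ?_, fun a b c d q hq => ⟨AAB.multipliable_one_sub_mul_pow hq, ?_⟩,
    AAB.toQuaternary_bijOn,
    fun l hl => ⟨AAB.weight_toQuaternary hl, fun p => AAB.count_toQuaternary p hl⟩⟩
  · have h1 := AAB.finite_refined_isDistinctPrimary u v w t n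
    exact ⟨h1, (AAB.toQuaternary_bijOn_refined u v w t n).finite_iff_finite.1
      ((AAB.glue_bijOn u v w t n).finite_iff_finite.1 h1), AAB.A_eq_B u v w t n⟩
  · have h := AAB.hasSum_distinctPrimary (fun p => match p with
      | .a => a | .b => b | .c => c | .d => d) hq
    have hp : (Finset.univ : Finset AAB.Primary) = {.a, .b, .c, .d} := rfl
    rw [hp, Finset.prod_insert (by decide), Finset.prod_insert (by decide),
      Finset.prod_insert (by decide), Finset.prod_singleton] at h
    simp only [AAB.A_eq_B, AAB.monomial] at h
    simpa only [mul_assoc] using h
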